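/- Let $n\ge 1$, put $m=n-1$, and let $W=\mathfrak S_n$ be the Coxeter group of type $A_{n-1}$ acting on $V=\{x\in\mathbb R^n:\sum_i x_i=0\}$ by permuting coordinates, with reflections the transpositions, simple reflections $s_i=(i,i+1)$ and positive roots $\Phi^+=\{e_i-e_j: i<j\}$. Let $c$ be a standard Coxeter element, i.e. a product of $s_1,\dots,s_{n-1}$, each used once, in some order. Set partitions are the subspaces of $V$ which are intersections of reflecting hyperplanes, ordered by reverse inclusion; the blocks of such a subspace $\pi$ are the classes of the relation "$x_i=x_j$ for all $x\in\pi$" on $\{1,\dots,n\}$. A set partition is noncrossing if it is $\mathrm{Fix}(w)$ for some $w\in W$ below or equal to $c$ in the absolute order ($u\le v$ if some minimal-length factorization of $u$ into reflections is a subword of one of $v$). Let $\mathcal M^{NC}(W,c)$ be the set of maximal chains $\Pi=(\pi_0\lessdot\pi_1\lessdot\dots\lessdot\pi_m)$, from $\pi_0=V$ to $\pi_m=\{0\}$, of the poset of noncrossing partitions. Say that $\pi'$ is an interval refinement of $\pi$ if the simple roots of the positive system $\Phi^+\cap\pi'^\perp$ are contained in those of $\Phi^+\cap\pi^\perp$.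 Let $\mathrm{nir}(\Pi)$ be the number of $i$ with $0\le i<m$ such that $\pi_i$ is not an interval refinement of $\pi_{i+1}$, let $[\Pi]=\{w(\Pi):w\in W\}\cap\mathcal M^{NC}(W,c)$, and let $M([\Pi],q)=\sum_{\Omega\in[\Pi]}q^{\mathrm{nir}(\Omega)}$. An André tree on $m$ vertices is a rooted tree (empty if $m=0$) in which every vertex has at most two sons, the sons being unordered, with vertices labelled bijectively by $1,\dots,m$ so that labels decrease from the root to the leaves. For a vertex $v$, the hook $h_v$ is the number of vertices of the subtree rooted at $v$ (including $v$). Let $\Pi\in\mathcal M^{NC}(W,c)$. Then for each $1\le i\le m$ exactly one block $b_i$ of $\pi_i$ is not a block of $\pi_{i-1}$, and there is exactly one André tree $T$ on the $m=n-1$ vertices $1,\dots,m$ such that $u$ is equal to or below $v$ in $T$ if and only if $b_u\subseteq b_v$ (the image of $\Pi$ under Stanley's bijection). For this tree, $$M([\Pi],q)=\prod_{v\in T,\ h_v\ne 1}\bigl(2+q(h_v-1)\bigr).$$ -/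

import Mathlib

/-!
The Coxeter group of type `A_m` is `W = 𝔖_{m+1} = Equiv.Perm (Fin (m + 1))`, acting on
`V = {x ∈ ℝ^{m+1} : ∑ x_i = 0}` by permutation of the coordinates.  Its reflections are the
transpositions, its simple reflections are the `s_i = (i, i+1)`, its roots are the `e_i - e_j`.
Subspaces of `V` are represented as subspaces of `ℝ^{m+1}` contained in `V`.
-/

namespace TypeA

/-- The Coxeter group of type `A_m`. -/
abbrev W (m : ℕ) : Type := Equiv.Perm (Fin (m + 1))

/-- Linear subspaces of `ℝ^{m+1}`. -/
abbrev Sub (m : ℕ) : Type := Submodule ℝ (Fin (m + 1) → ℝ)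

/-- The geometric representation `V = {x : ∑ x_i = 0}`. -/
def V (m : ℕ) : Sub m where
  carrier := {x | ∑ i, x i = 0}
  add_mem' := by
    intro a b ha hb
    simp only [Set.mem_ofPred_eq, Pi.add_apply, Finset.sum_add_distrib] at *
    rw [ha, hb, add_zero]
  zero_mem' := by simp
  smul_mem' := by
    intro r a ha
    simp only [Set.mem_ofPred_eq, Pi.smul_apply, smul_eq_mul, ← Finset.mul_sum] at *
    rw [ha, mul_zero]

/-- The action of `w` on vectors, `(w x)_i = x_{w⁻¹ i}` (so that `w e_i = e_{w i}`). -/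
def act {m : ℕ} (w : W m) : (Fin (m + 1) → ℝ) →ₗ[ℝ] (Fin (m + 1) → ℝ) :=
  LinearMap.funLeft ℝ ℝ (⇑w⁻¹)

/-- `Fix(w) = {x ∈ V : w x = x}`. -/
def fix {m : ℕ} (w : W m) : Sub m :=
  V m ⊓ LinearMap.eqLocus (act w) LinearMap.id

/-- The set `𝒫(W)` of set partitions: the subspaces of `V` which are intersections of reflecting
hyperplanes `Fix(t)`, `t` a reflection (the empty intersection is `V`). It is ordered by reverse
inclusion. -/
def partitions (m : ℕ) : Set (Sub m) :=
  {L | ∃ A : Set (W m), (∀ t ∈ A, t.IsSwap) ∧ L = V m ⊓ ⨅ t ∈ A, fix t}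

/-! ### Interval refinement -/

/-- The positive roots `e_i - e_j`, `i < j`. -/
def posRoots (m : ℕ) : Set (Fin (m + 1) → ℝ) :=
  {α | ∃ i j : Fin (m + 1), i < j ∧ α = Pi.single i 1 - Pi.single j 1}

/-- The positive roots `Φ⁺ ∩ L^⊥` of the pointwise stabilizer of `L`. -/
def posRootsOf {m : ℕ} (L : Sub m) : Set (Fin (m + 1) → ℝ) :=
  {α | α ∈ posRoots m ∧ ∀ x ∈ L, dotProduct α x = 0}

/-- The simple roots of the pointwise stabilizer of `L`: the indecomposable elements of
`Φ⁺ ∩ L^⊥`, i.e. those which are not the sum of two elements of `Φ⁺ ∩ L^⊥`. -/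
def simpleRootsOf {m : ℕ} (L : Sub m) : Set (Fin (m + 1) → ℝ) :=
  {α | α ∈ posRootsOf L ∧ ∀ β ∈ posRootsOf L, ∀ γ ∈ posRootsOf L, α ≠ β + γ}

/-- `L₂ ⊑ L₁`: `L₂` is an interval refinement of `L₁`. -/
def IntervalRefinement {m : ℕ} (L₂ L₁ : Sub m) : Prop :=
  simpleRootsOf L₂ ⊆ simpleRootsOf L₁

/-! ### Noncrossing partitions and their maximal chains -/

/-- `l` is a reduced `T`-word of `w`, where `T` is the set of reflections. -/
def IsReducedTWord {m : ℕ} (l : List (W m)) (w : W m) : Prop :=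
  (∀ t ∈ l, t.IsSwap) ∧ l.prod = w ∧
    ∀ l' : List (W m), (∀ t ∈ l', t.IsSwap) → l'.prod = w → l.length ≤ l'.length

/-- The (reflexive) absolute order: some reduced `T`-word of `u` is a subword of some reduced
`T`-word of `v`. -/
def AbsLE {m : ℕ} (u v : W m) : Prop :=
  ∃ l l' : List (W m), IsReducedTWord l u ∧ IsReducedTWord l' v ∧ l.Sublist l'

/-- The simple reflection exchanging two consecutive indices. -/
def simpleReflection {m : ℕ} (i : Fin m) : W m :=
  Equiv.swap i.castSucc i.succ

/-- `c` is a standard Coxeter element: the product of the simple reflections, each used once,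
in some order. -/
def IsStandardCoxeter {m : ℕ} (c : W m) : Prop :=
  ∃ σ : Equiv.Perm (Fin m), c = (List.ofFn fun k => simpleReflection (σ k)).prod

/-- `𝒫^NC(W, c)`: the partitions of the form `Fix(w)` with `w` below `c` in the absolute order. -/
def noncrossing {m : ℕ} (c : W m) : Set (Sub m) :=
  {L | L ∈ partitions m ∧ ∃ w : W m, AbsLE w c ∧ L = fix w}

/-- The cover relation `L ⋖ L'` of the poset `𝒫^NC(W, c)` (ordered by reverse inclusion). -/
def NCCovers {m : ℕ} (c : W m) (L L' : Sub m) : Prop :=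
  L ∈ noncrossing c ∧ L' ∈ noncrossing c ∧ L' < L ∧
    ∀ K ∈ noncrossing c, ¬ (L' < K ∧ K < L)

/-- `𝓜^NC(W, c)`: the maximal chains `0̂ = π_0 ⋖ π_1 ⋖ ⋯ ⋖ π_m = 1̂` of `𝒫^NC(W, c)`, where
`0̂ = V` and `1̂ = {0}`. -/
def ncChains {m : ℕ} (c : W m) : Set (Fin (m + 1) → Sub m) :=
  {P | P 0 = V m ∧ P (Fin.last m) = ⊥ ∧ ∀ i : Fin m, NCCovers c (P i.castSucc) (P i.succ)}

open Classical in
/-- `nir(Π)`: the number of `i` such that `π_i` is not an interval refinement of `π_{i+1}`. -/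
noncomputable def nir {m : ℕ} (P : Fin (m + 1) → Sub m) : ℕ :=
  (Finset.univ.filter fun i : Fin m => ¬ IntervalRefinement (P i.castSucc) (P i.succ)).card

/-- The chain `w(Π)`. -/
def actChain {m : ℕ} (w : W m) (P : Fin (m + 1) → Sub m) : Fin (m + 1) → Sub m :=
  fun i => (P i).map (act w)

open Classical in
/-- The class `[Π] = {w(Π) : w ∈ W} ∩ 𝓜^NC(W, c)`. -/
noncomputable def chainClass {m : ℕ} (c : W m) (P : Fin (m + 1) → Sub m) :
    Finset (Fin (m + 1) → Sub m) :=
  (Finset.univ.image fun w : W m => actChain w P).filter fun Q => Q ∈ ncChains c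

/-- The class generating function `M([Π], q) = ∑_{Ω ∈ [Π]} q^{nir(Ω)}`. -/
noncomputable def classGenFun {m : ℕ} (c : W m) (P : Fin (m + 1) → Sub m) : Polynomial ℤ :=
  ∑ Q ∈ chainClass c P, Polynomial.X ^ nir Q

/-! ### André trees and Stanley's bijection -/

/-- André trees on `m` vertices: rooted trees in which every vertex has at most two sons, the
sons being unordered, with vertices labelled bijectively by `1, …, m` such that the labels decrease
from the root to the leaves. The vertices are identified with their labels, the label `i + 1`
being `i : Fin m`; the tree is given by its parent function. (There is always a root when `m ≥ 1`,
since labels increase strictly towards it; for `m = 0` the tree is empty.) -/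
@[ext]
structure AndreTree (m : ℕ) where
  /-- The father of a vertex, `none` for the root. -/
  parent : Fin m → Option (Fin m)
  lt_parent : ∀ u v, parent u = some v → u < v
  root_unique : ∀ u v, parent u = none → parent v = none → u = v
  card_sons_le_two : ∀ v, (Finset.univ.filter fun u => parent u = some v).card ≤ 2

/-- `u` is `v` or a descendant of `v`. -/
def AndreTree.Below {m : ℕ} (T : AndreTree m) (u v : Fin m) : Prop :=
  Relation.ReflTransGen (fun a b => T.parent a = some b) u v

/-- The hook `h_v`: the number of vertices of the subtree with root `v`. -/
noncomputable def AndreTree.hook {m : ℕ} (T : AndreTree m) (v : Fin m) : ℕ :=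
  {u | T.Below u v}.ncard

/-- The blocks of the set partition of `{1, …, m+1}` corresponding to the subspace `L`: `i` and `j`
lie in the same block when `x_i = x_j` for all `x ∈ L`. -/
def blocks {m : ℕ} (L : Sub m) : Set (Set (Fin (m + 1))) :=
  {b | ∃ i, b = {j | ∀ x ∈ L, x j = x i}}

/-- `T` is the image of the chain `Π` under Stanley's map: the vertex with label `i` represents
the block `b_i` which appears at the `i`-th merging (the one block of `π_i` which is not a block of
`π_{i-1}`), and `u` is below `v` in the tree exactly when `b_u ⊆ b_v`. -/
def IsStanleyImage {m : ℕ} (P : Fin (m + 1) → Sub m) (T : AndreTree m) : Prop :=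
  ∃ b : Fin m → Set (Fin (m + 1)),
    (∀ i : Fin m, blocks (P i.succ) \ blocks (P i.castSucc) = {b i}) ∧
    ∀ u v : Fin m, T.Below u v ↔ b u ⊆ b v

end TypeA

/-! ### Subspaces, equivalence relations and the dimension of the fixed space -/

namespace TypeA

open Equiv Equiv.Perm

variable {m : ℕ}

/-! A maximal chain is a sequence of equivalence relations on `Fin (m + 1)`, each obtained from the
previous one by merging two classes; let `B` be the class created by a given merging. The sum over
`[Π]` becomes a sum over those `w` for which `w(Π)` is noncrossing, and the mergings are undone from
the last to the first, one factor each.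

Suppose the coarser partition of a merging is mapped by `w` to `Fix(v)` with `v` below `c`. Then `B`
is mapped to a cycle `C` of `v`, and a splitting of `C` into parts of prescribed sizes is
noncrossing exactly when the parts are arcs of the cycle (`Merges.mem_noncrossing_iff`, resting on
`exit_unique`). This leaves `|C|` splittings, whatever the sizes (`card_arcs`). The merging is an
interval refinement exactly when one part lies to the left of the other
(`Merges.intervalRefinement_iff`). Only the initial and the final segment of the right size do so,
and they are arcs because a standard Coxeter element leaves each set `{i ≤ t}` at most once, a
property inherited by the cycles of `v` (`exit_unique_of_cutProperty`). Each merging thus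
contributes `2 + q(|C| - 2)`, independently of the choices made for the later ones, and
`sum_prod_eq_prod` multiplies these factors.

Several `w` may give the same chain, but only through exchanging the two elements of blocks of size
two: in a larger block the two parts are distinguished by the times of their creation. Requiring `w`
to be increasing on such blocks selects one `w` per chain (`IsMergeChain.exists_normalized`,
`IsMergeChain.eq_of_normalized`) and makes their factor `1`. Finally a class of size `s` takes `s -
1` mergings to build, so a vertex with block `B` has hook `|B| - 1` (`IsMergeChain.hook_add_one`).

All facts about the absolute order are derived from dimensions: the reflection length of `u` is `m -
dimFix u`, so `u` is below `c` exactly when codimensions add up in `c = (c u⁻¹) u`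
(`absLE_iff_under`). -/

lemma inv_apply_apply {α : Type*} (u : Perm α) (i : α) : u⁻¹ (u i) = i := u.symm_apply_apply i

lemma apply_inv_apply {α : Type*} (u : Perm α) (i : α) : u (u⁻¹ i) = i := u.apply_symm_apply i

/-- The dimension of the fixed space of `u`. -/
noncomputable def dimFix (u : W m) : ℕ := Module.finrank ℝ (fix u)

/-- The equivalence relation on coordinates defined by a subspace. -/
def relOf (L : Sub m) : Setoid (Fin (m + 1)) where
  r i j := ∀ x ∈ L, x i = x j
  iseqv := ⟨fun _ _ _ => rfl, fun h x hx => (h x hx).symm,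
    fun h h' x hx => (h x hx).trans (h' x hx)⟩

/-- The subspace of `V` of vectors constant on the classes of `r`. -/
def subOf (r : Setoid (Fin (m + 1))) : Sub m where
  carrier := {x | x ∈ V m ∧ ∀ i j, r i j → x i = x j}
  add_mem' := fun ha hb => ⟨add_mem ha.1 hb.1, fun i j h => by
    simp only [Pi.add_apply, ha.2 i j h, hb.2 i j h]⟩
  zero_mem' := ⟨zero_mem _, fun _ _ _ => rfl⟩
  smul_mem' := fun c x hx => ⟨Submodule.smul_mem _ c hx.1, fun i j h => by
    simp only [Pi.smul_apply, hx.2 i j h]⟩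

lemma mem_V {x : Fin (m + 1) → ℝ} : x ∈ V m ↔ ∑ i, x i = 0 := Iff.rfl

lemma mem_subOf {r : Setoid (Fin (m + 1))} {x : Fin (m + 1) → ℝ} :
    x ∈ subOf r ↔ x ∈ V m ∧ ∀ i j, r i j → x i = x j := Iff.rfl

lemma relOf_iff {L : Sub m} {i j : Fin (m + 1)} : relOf L i j ↔ ∀ x ∈ L, x i = x j := Iff.rfl

lemma act_apply (w : W m) (x : Fin (m + 1) → ℝ) (i : Fin (m + 1)) :
    act w x i = x (w⁻¹ i) := rfl

lemma mem_fix {u : W m} {x : Fin (m + 1) → ℝ} :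
    x ∈ fix u ↔ x ∈ V m ∧ ∀ i, x (u i) = x i := by
  simp only [fix, Submodule.mem_inf, LinearMap.mem_eqLocus, LinearMap.id_coe, id_eq]
  refine and_congr_right fun _ => ⟨fun h i => ?_, fun h => funext fun i => ?_⟩
  · have := congrFun h (u i)
    rw [act_apply, inv_apply_apply] at this
    exact this.symm
  · have := h (u⁻¹ i)
    rw [apply_inv_apply] at this
    exact this.symm

lemma eq_of_sameCycle {u : W m} {x : Fin (m + 1) → ℝ} (hx : ∀ i, x (u i) = x i)
    {i j : Fin (m + 1)} (h : SameCycle u i j) : x i = x j := by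
  obtain ⟨k, rfl⟩ := h
  have hn : ∀ (k : ℕ) i, x ((u ^ k) i) = x i := by
    intro k
    induction k with
    | zero => intro i; rfl
    | succ k ih => intro i; rw [pow_succ', Perm.mul_apply, hx, ih]
  cases k with
  | ofNat k => simpa using (hn k i).symm
  | negSucc k =>
    have := hn (k + 1) ((u ^ (Int.negSucc k)) i)
    rw [← this, zpow_negSucc, apply_inv_apply]

lemma fix_eq_subOf (u : W m) : fix u = subOf (SameCycle.setoid u) := by
  ext x
  rw [mem_fix, mem_subOf]
  refine and_congr_right fun _ => ⟨fun h i j hij => eq_of_sameCycle h hij, fun h i => ?_⟩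
  exact h _ _ (sameCycle_apply_left.2 (SameCycle.refl u i))

open Classical in
lemma exists_separating (r : Setoid (Fin (m + 1))) {i j : Fin (m + 1)} (h : ¬ r i j) :
    ∃ x ∈ subOf r, x i ≠ x j := by
  set k : ℝ := ∑ l, if r i l then (1 : ℝ) else 0 with hk
  -- The indicator of the class of `i`, with its mean subtracted so that it lies in `V`.
  refine ⟨fun l => (if r i l then 1 else 0) - k / (m + 1), ⟨?_, ?_⟩, ?_⟩
  · rw [mem_V, Finset.sum_sub_distrib, ← hk]
    simp only [Finset.sum_const, Finset.card_univ, Fintype.card_fin, nsmul_eq_mul]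
    push_cast
    field_simp
    ring
  · intro a b hab
    have : r i a ↔ r i b := ⟨fun h => r.trans h hab, fun h => r.trans h (r.symm hab)⟩
    simp only [this]
  · simp [h]

lemma relOf_subOf (r : Setoid (Fin (m + 1))) : relOf (subOf r) = r := by
  ext i j
  refine ⟨fun h => ?_, fun h x hx => hx.2 i j h⟩
  by_contra hn
  obtain ⟨x, hx, hne⟩ := exists_separating r hn
  exact hne (h x hx)

lemma subOf_injective : Function.Injective (subOf (m := m)) := fun r s h => by
  rw [← relOf_subOf r, h, relOf_subOf]

lemma relOf_fix {u : W m} {i j : Fin (m + 1)} : relOf (fix u) i j ↔ SameCycle u i j := by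
  rw [fix_eq_subOf, relOf_subOf]; rfl

lemma subOf_relOf_fix (u : W m) : subOf (relOf (fix u)) = fix u := by
  rw [fix_eq_subOf, relOf_subOf]

lemma subOf_le_subOf {r s : Setoid (Fin (m + 1))} : subOf s ≤ subOf r ↔ r ≤ s := by
  refine ⟨fun h i j hij => ?_, fun h x hx => ⟨hx.1, fun i j hij => hx.2 i j (h hij)⟩⟩
  rw [← relOf_subOf s]
  exact fun x hx => (h hx).2 i j hij

lemma map_act_subOf (w : W m) (r : Setoid (Fin (m + 1))) :
    (subOf r).map (act w) = subOf (r.comap ⇑w⁻¹) := by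
  ext x
  rw [Submodule.mem_map, mem_subOf]
  constructor
  · rintro ⟨y, hy, rfl⟩
    refine ⟨?_, fun i j hij => hy.2 _ _ hij⟩
    rw [mem_V]
    exact (Equiv.sum_comp (w⁻¹) y).trans hy.1
  · rintro ⟨h1, h2⟩
    refine ⟨x ∘ w, ⟨?_, fun i j hij => h2 _ _ ?_⟩, ?_⟩
    · rw [mem_V]
      exact (Equiv.sum_comp w x).trans h1
    · rw [Setoid.comap_rel]
      simpa using hij
    · ext i
      simp [act_apply]

lemma fix_one : fix (1 : W m) = V m := by
  ext x; rw [mem_fix]; simp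

lemma finrank_V : Module.finrank ℝ (V m) = m := by
  let f : (Fin (m + 1) → ℝ) →ₗ[ℝ] ℝ := ∑ i, LinearMap.proj i
  have hV : V m = LinearMap.ker f := by
    ext x
    rw [mem_V, LinearMap.mem_ker]
    simp [f]
  have hf : Function.Surjective f := fun y => ⟨Pi.single 0 y, by simp [f]⟩
  have h := LinearMap.finrank_range_add_finrank_ker f
  rw [LinearMap.range_eq_top.2 hf, finrank_top, ← hV] at h
  simp at h
  omega

lemma fix_le_V (u : W m) : fix u ≤ V m := inf_le_left

lemma dimFix_le (u : W m) : dimFix u ≤ m :=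
  (Submodule.finrank_mono (fix_le_V u)).trans finrank_V.le

/-- The hyperplane `x_a = x_b`. -/
def hyp (a b : Fin (m + 1)) : Sub m :=
  LinearMap.ker ((LinearMap.proj a : (Fin (m + 1) → ℝ) →ₗ[ℝ] ℝ) - LinearMap.proj b)

lemma mem_hyp {a b : Fin (m + 1)} {x : Fin (m + 1) → ℝ} : x ∈ hyp a b ↔ x a = x b := by
  simp [hyp, sub_eq_zero]

lemma finrank_inf_hyp (L : Sub m) (a b : Fin (m + 1)) :
    Module.finrank ℝ L ≤ Module.finrank ℝ (L ⊓ hyp a b : Sub m) + 1 := by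
  have h := Submodule.finrank_sup_add_finrank_inf_eq L (hyp a b)
  have h1 := LinearMap.finrank_range_add_finrank_ker
    ((LinearMap.proj a : (Fin (m + 1) → ℝ) →ₗ[ℝ] ℝ) - LinearMap.proj b)
  have h2 := Submodule.finrank_le (LinearMap.range
    ((LinearMap.proj a : (Fin (m + 1) → ℝ) →ₗ[ℝ] ℝ) - LinearMap.proj b))
  have h3 := Submodule.finrank_le (L ⊔ hyp a b)
  change _ + Module.finrank ℝ (hyp a b) = _ at h1
  simp at h1 h2 h3
  omega

lemma dimFix_add_le_finrank_inf (u v : W m) : dimFix u + dimFix v ≤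
    Module.finrank ℝ (fix u ⊓ fix v : Sub m) + m := by
  have h := Submodule.finrank_sup_add_finrank_inf_eq (fix u) (fix v)
  have h3 := Submodule.finrank_mono (sup_le (fix_le_V u) (fix_le_V v))
  rw [finrank_V] at h3
  unfold dimFix
  omega

lemma fix_inf_fix_le (u v : W m) : fix u ⊓ fix v ≤ fix (u * v) := by
  rintro x ⟨h1, h2⟩
  rw [SetLike.mem_coe, mem_fix] at h1 h2
  exact mem_fix.2 ⟨h1.1, fun i => by rw [Perm.mul_apply, h1.2, h2.2]⟩

lemma dimFix_add_le (u v : W m) : dimFix u + dimFix v ≤ dimFix (u * v) + m :=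
  (dimFix_add_le_finrank_inf u v).trans (Nat.add_le_add_right (Submodule.finrank_mono (fix_inf_fix_le u v)) _)

open Classical in
lemma fix_mul_swap {u : W m} {a b : Fin (m + 1)} (h : ¬ SameCycle u a b) :
    fix (u * swap a b) = fix u ⊓ hyp a b := by
  have hab : a ≠ b := fun e => h (e ▸ SameCycle.refl u a)
  ext x
  rw [Submodule.mem_inf, mem_fix, mem_fix, mem_hyp]
  constructor
  · rintro ⟨hV, hx⟩
    have hx' : ∀ i, x (u i) = x (swap a b i) := fun i => by
      have := hx (swap a b i)
      rwa [Perm.mul_apply, swap_apply_self] at this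
    -- Sum `x (u i) = x (swap a b i)` over the `u`-cycle of `a`, which does not contain `b`: the
    -- left side gives the sum of `x` over the cycle, the right side the same sum with `x a`
    -- replaced by `x b`.
    have key : x a = x b := by
      let O : Finset (Fin (m + 1)) := Finset.univ.filter fun i => SameCycle u a i
      have h1 : ∑ i ∈ O, x (u i) = ∑ i ∈ O, x i := by
        refine Finset.sum_bijective u u.bijective ?_ (fun _ _ => rfl)
        intro i
        simp [O, sameCycle_apply_right]
      have haO : a ∈ O := by simp [O, SameCycle.refl]
      have h2 : ∑ i ∈ O, x (swap a b i) = x b + ∑ i ∈ O.erase a, x i := by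
        rw [← Finset.add_sum_erase _ _ haO, swap_apply_left]
        congr 1
        refine Finset.sum_congr rfl fun i hi => ?_
        rw [swap_apply_of_ne_of_ne (Finset.ne_of_mem_erase hi)]
        rintro rfl
        exact h (by simpa [O] using Finset.mem_of_mem_erase hi)
      have h3 := Finset.add_sum_erase _ x haO
      simp only [hx'] at h1
      linarith
    refine ⟨⟨hV, fun i => ?_⟩, key⟩
    rw [hx' i]
    by_cases hia : i = a
    · subst hia; rw [swap_apply_left, key]
    · by_cases hib : i = b
      · subst hib; rw [swap_apply_right, key]
      · rw [swap_apply_of_ne_of_ne hia hib]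
  · rintro ⟨⟨hV, hx⟩, key⟩
    refine ⟨hV, fun i => ?_⟩
    rw [Perm.mul_apply, hx]
    by_cases hia : i = a
    · subst hia; rw [swap_apply_left, key]
    · by_cases hib : i = b
      · subst hib; rw [swap_apply_right, key]
      · rw [swap_apply_of_ne_of_ne hia hib]

lemma exists_mem_fix_ne {u : W m} {a b : Fin (m + 1)} (h : ¬ SameCycle u a b) :
    ∃ x ∈ fix u, x a ≠ x b := by
  rw [fix_eq_subOf]
  exact exists_separating (SameCycle.setoid u) h

lemma dimFix_mul_swap {u : W m} {a b : Fin (m + 1)} (h : ¬ SameCycle u a b) :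
    dimFix (u * swap a b) + 1 = dimFix u := by
  have h1 := finrank_inf_hyp (fix u) a b
  have h2 : fix u ⊓ hyp a b < fix u := by
    refine lt_of_le_of_ne inf_le_left fun e => ?_
    obtain ⟨x, hx, hne⟩ := exists_mem_fix_ne h
    rw [← e] at hx
    exact hne (mem_hyp.1 hx.2)
  have h3 := Submodule.finrank_lt_finrank_of_lt h2
  unfold dimFix
  rw [fix_mul_swap h]
  omega

/-- With `k` minimal such that `u ^ k` sends `a` to `b`, the set `{u a, …, u ^ k a = b}` is stable
under `u * swap a b` and contains `b` but not `a`. -/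
lemma not_sameCycle_mul_swap {u : W m} {a b : Fin (m + 1)} (h : SameCycle u a b) (hab : a ≠ b) :
    ¬ SameCycle (u * swap a b) a b := by
  classical
  have hex : ∃ k : ℕ, (u ^ k) a = b := by
    obtain ⟨k, -, hk⟩ := h.exists_pow_eq'
    exact ⟨k, hk⟩
  set k := Nat.find hex with hk
  have hkb : (u ^ k) a = b := Nat.find_spec hex
  have hmin : ∀ i < k, (u ^ i) a ≠ b := fun i hi => Nat.find_min hex hi
  have hk1 : k ≠ 0 := by
    intro h0
    rw [h0] at hkb
    exact hab hkb
  have hmina : ∀ i, 1 ≤ i → i ≤ k → (u ^ i) a ≠ a := by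
    intro i hi hik e
    apply hmin (k - i) (by omega)
    conv_lhs => rw [← e]
    rw [← Perm.mul_apply, ← pow_add, Nat.sub_add_cancel hik, hkb]
  have hS : ∀ y, (∃ i, 1 ≤ i ∧ i ≤ k ∧ (u ^ i) a = y) →
      ∃ i, 1 ≤ i ∧ i ≤ k ∧ (u ^ i) a = (u * swap a b) y := by
    rintro y ⟨i, hi, hik, rfl⟩
    rcases hik.lt_or_eq with hlt | rfl
    · refine ⟨i + 1, by omega, by omega, ?_⟩
      rw [Perm.mul_apply, swap_apply_of_ne_of_ne (hmina i hi hik) (hmin i hlt), pow_succ',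
        Perm.mul_apply]
    · refine ⟨1, le_rfl, hi, ?_⟩
      rw [hkb, Perm.mul_apply, swap_apply_right, pow_one]
  intro hc
  obtain ⟨l, -, hl⟩ := hc.symm.exists_pow_eq'
  have : ∀ l : ℕ, ∃ i, 1 ≤ i ∧ i ≤ k ∧ (u ^ i) a = ((u * swap a b) ^ l) b := by
    intro l
    induction l with
    | zero => exact ⟨k, by omega, le_rfl, hkb⟩
    | succ l ih =>
      rw [pow_succ', Perm.mul_apply]
      exact hS _ ih
  obtain ⟨i, h1, h2, h3⟩ := this l
  exact hmina i h1 h2 (h3.trans hl)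

lemma dimFix_mul_swap_of_sameCycle {u : W m} {a b : Fin (m + 1)} (h : SameCycle u a b)
    (hab : a ≠ b) : dimFix (u * swap a b) = dimFix u + 1 := by
  have := dimFix_mul_swap (not_sameCycle_mul_swap h hab)
  rw [mul_assoc, swap_mul_self, mul_one] at this
  exact this.symm

/-- Each reflection lowers the dimension of the fixed space by at most one. Together with
`exists_swap_word` this identifies the reflection length with the codimension of the fixed space. -/
lemma sub_le_dimFix_prod (l : List (W m)) (hl : ∀ t ∈ l, t.IsSwap) :
    m ≤ dimFix l.prod + l.length := by
  induction l with
  | nil => rw [List.prod_nil, dimFix, fix_one, finrank_V]; simp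
  | cons t l ih =>
    have h1 := ih fun t ht => hl t (List.mem_cons_of_mem _ ht)
    obtain ⟨a, b, hab, rfl⟩ := hl t List.mem_cons_self
    have h2 := dimFix_add_le (swap a b) l.prod
    have h3 : m ≤ dimFix (swap a b) + 1 := by
      have h4 := dimFix_mul_swap (u := (1 : W m)) (a := a) (b := b) (by simpa using hab)
      rw [one_mul] at h4
      rw [h4, dimFix, fix_one, finrank_V]
    rw [List.prod_cons, List.length_cons]
    omega

lemma eq_one_of_dimFix {u : W m} (h : m ≤ dimFix u) : u = 1 := by
  by_contra hne
  obtain ⟨a, ha⟩ : ∃ a, u a ≠ a := by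
    by_contra! hall
    exact hne (Equiv.ext hall)
  have h1 := dimFix_mul_swap_of_sameCycle (u := u)
    (sameCycle_apply_right.2 (SameCycle.refl u a)) ha.symm
  have h2 := dimFix_le (u * swap a (u a))
  omega

/-- As long as some `a` is moved, multiplying by `swap a (u a)` splits a cycle and gains one
dimension. -/
lemma exists_swap_word (u : W m) :
    ∃ l : List (W m), (∀ t ∈ l, t.IsSwap) ∧ l.prod = u ∧ l.length + dimFix u = m := by
  induction hk : m - dimFix u generalizing u with
  | zero =>
    have h1 := dimFix_le u
    have := eq_one_of_dimFix (u := u) (by omega)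
    subst this
    exact ⟨[], by simp, rfl, by simp; omega⟩
  | succ k ih =>
    obtain ⟨a, ha⟩ : ∃ a, u a ≠ a := by
      by_contra! hall
      have : u = 1 := Equiv.ext hall
      subst this
      rw [dimFix, fix_one, finrank_V] at hk
      omega
    have h1 := dimFix_mul_swap_of_sameCycle (u := u)
      (sameCycle_apply_right.2 (SameCycle.refl u a)) ha.symm
    obtain ⟨l, h2, h3, h4⟩ := ih (u * swap a (u a)) (by omega)
    refine ⟨l ++ [swap a (u a)], ?_, ?_, ?_⟩
    · intro t ht
      rcases List.mem_append.1 ht with ht | ht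
      · exact h2 t ht
      · rw [List.mem_singleton.1 ht]; exact ⟨a, u a, ha.symm, rfl⟩
    · rw [List.prod_append, h3, List.prod_singleton, mul_assoc, swap_mul_self, mul_one]
    · rw [List.length_append, List.length_singleton]; omega

end TypeA

/-! ### The absolute order below an element with trivial fixed space -/

namespace TypeA

open Equiv Equiv.Perm

variable {m : ℕ}

lemma fix_mem_partitions (u : W m) : fix u ∈ partitions m := by
  refine ⟨{t | ∃ a b, a ≠ b ∧ SameCycle u a b ∧ t = swap a b}, ?_, ?_⟩
  · rintro t ⟨a, b, hab, -, rfl⟩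
    exact ⟨a, b, hab, rfl⟩
  · ext x
    simp only [Submodule.mem_inf, Submodule.mem_iInf, Set.mem_ofPred_eq]
    rw [fix_eq_subOf, mem_subOf]
    refine and_congr_right fun hV => ⟨?_, fun h i j hij => ?_⟩
    · rintro h t ⟨a, b, hab, hs, rfl⟩
      refine mem_fix.2 ⟨hV, fun i => ?_⟩
      have : x a = x b := h a b hs
      by_cases hia : i = a
      · subst hia; rw [swap_apply_left, this]
      · by_cases hib : i = b
        · subst hib; rw [swap_apply_right, this]
        · rw [swap_apply_of_ne_of_ne hia hib]
    · by_cases e : i = j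
      · rw [e]
      · have := (mem_fix.1 (h _ ⟨i, j, e, hij, rfl⟩)).2 j
        rwa [swap_apply_right] at this

/-- `u` lies below `c` in the absolute order, in terms of dimensions of fixed spaces
(for `c` with trivial fixed space). -/
def Under (c u : W m) : Prop := dimFix (c * u⁻¹) + dimFix u = m

/-- The letters outside the subword can be pushed to the left: passing a kept letter `a` conjugates
them by `a`, and conjugates of reflections are reflections. -/
lemma exists_prod_eq_of_sublist {l l' : List (W m)} (h : l.Sublist l')
    (hl' : ∀ t ∈ l', t.IsSwap) :
    ∃ r : List (W m), (∀ t ∈ r, t.IsSwap) ∧ l'.prod = r.prod * l.prod ∧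
      r.length + l.length = l'.length := by
  induction h with
  | slnil => exact ⟨[], by simp, by simp, rfl⟩
  | cons a _ ih =>
    obtain ⟨r, h1, h2, h3⟩ := ih fun t ht => hl' t (List.mem_cons_of_mem _ ht)
    refine ⟨a :: r, ?_, ?_, ?_⟩
    · intro t ht
      rcases List.mem_cons.1 ht with rfl | ht
      · exact hl' _ List.mem_cons_self
      · exact h1 t ht
    · rw [List.prod_cons, List.prod_cons, h2, mul_assoc]
    · simp only [List.length_cons]; omega
  | cons_cons a _ ih =>
    obtain ⟨r, h1, h2, h3⟩ := ih fun t ht => hl' t (List.mem_cons_of_mem _ ht)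
    refine ⟨r.map (MulAut.conj a), ?_, ?_, ?_⟩
    · intro t ht
      obtain ⟨s, hs, rfl⟩ := List.mem_map.1 ht
      obtain ⟨x, y, hxy, rfl⟩ := h1 s hs
      refine ⟨a x, a y, fun e => hxy (a.injective e), ?_⟩
      rw [MulAut.conj_apply, swap_apply_apply]
    · rw [List.prod_cons, List.prod_cons, ← map_list_prod, h2, MulAut.conj_apply]
      group
    · simp only [List.length_cons, List.length_map]; omega

lemma dimFix_mul_inv_add_le {c : W m} (hc : dimFix c = 0) (u : W m) :
    dimFix (c * u⁻¹) + dimFix u ≤ m := by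
  have := dimFix_add_le (c * u⁻¹) u
  rwa [inv_mul_cancel_right, hc, zero_add] at this

lemma absLE_iff_under {c : W m} (hc : dimFix c = 0) (u : W m) : AbsLE u c ↔ Under c u := by
  constructor
  · rintro ⟨l, l', ⟨h1, h2, -⟩, ⟨h3, h4, h5⟩, hs⟩
    obtain ⟨w, hw1, hw2, hw3⟩ := exists_swap_word c
    have h6 := h5 w hw1 hw2
    obtain ⟨r, hr1, hr2, hr3⟩ := exists_prod_eq_of_sublist hs h3
    rw [h4, h2] at hr2
    have h7 := sub_le_dimFix_prod r hr1
    have h8 := sub_le_dimFix_prod l h1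
    have h9 := dimFix_mul_inv_add_le hc u
    have : c * u⁻¹ = r.prod := by rw [hr2, mul_inv_cancel_right]
    rw [h2] at h8
    unfold Under
    rw [this] at h9 ⊢
    omega
  · intro h
    have hmin : ∀ (w : W m) (l : List (W m)), l.length + dimFix w = m →
        ∀ l' : List (W m), (∀ t ∈ l', t.IsSwap) → l'.prod = w → l.length ≤ l'.length := by
      rintro w l hl l' h1 rfl
      have := sub_le_dimFix_prod l' h1
      omega
    obtain ⟨l, hl1, hl2, hl3⟩ := exists_swap_word u
    obtain ⟨r, hr1, hr2, hr3⟩ := exists_swap_word (c * u⁻¹)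
    refine ⟨l, r ++ l, ⟨hl1, hl2, hmin u l hl3⟩, ⟨?_, ?_, hmin c _ ?_⟩,
      List.sublist_append_right r l⟩
    · intro t ht
      rcases List.mem_append.1 ht with ht | ht
      · exact hr1 t ht
      · exact hl1 t ht
    · rw [List.prod_append, hr2, hl2, inv_mul_cancel_right]
    · unfold Under at h
      rw [List.length_append]
      omega

lemma mem_noncrossing_iff {c : W m} (hc : dimFix c = 0) {L : Sub m} :
    L ∈ noncrossing c ↔ ∃ u, Under c u ∧ L = fix u := by
  simp only [noncrossing, Set.mem_ofPred_eq, absLE_iff_under hc]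
  refine ⟨fun h => h.2, fun ⟨u, h, e⟩ => ⟨?_, u, h, e⟩⟩
  rw [e]
  exact fix_mem_partitions u

/-- Splitting a cycle of `v` gains a dimension, while `c * v⁻¹` is multiplied by one reflection and
loses at most one; the general upper bound on the sum forces equality. -/
lemma Under.mul_swap {c v : W m} (hc : dimFix c = 0) (h : Under c v) {a b : Fin (m + 1)}
    (hab : SameCycle v a b) (hne : a ≠ b) : Under c (v * swap a b) := by
  have h1 := dimFix_mul_swap_of_sameCycle hab hne
  have h2 := dimFix_mul_inv_add_le hc (v * swap a b)
  have h3 : c * (v * swap a b)⁻¹ = (c * v⁻¹) * swap (v a) (v b) := by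
    rw [swap_apply_apply, mul_inv_rev, swap_inv]
    group
  have h4 : m ≤ dimFix (swap (v a) (v b)) + 1 := by
    have := sub_le_dimFix_prod [swap (v a) (v b)]
      (by simpa using ⟨v a, v b, fun e => hne (v.injective e), rfl⟩)
    simpa using this
  have h5 := dimFix_add_le (c * v⁻¹) (swap (v a) (v b))
  unfold Under at *
  rw [h3] at h2 ⊢
  omega

/-- Additivity of codimensions forces the inclusion `fix r ⊓ fix u ≤ fix (r * u)` to be an equality.
-/
lemma fix_le_fix_of_dimFix {r u : W m} (h : m + dimFix (r * u) ≤ dimFix r + dimFix u) :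
    fix (r * u) ≤ fix u := by
  have h1 := dimFix_add_le_finrank_inf r u
  have h2 : fix r ⊓ fix u = fix (r * u) :=
    Submodule.eq_of_le_of_finrank_le (fix_inf_fix_le r u) (by unfold dimFix at *; omega)
  rw [← h2]
  exact inf_le_right

lemma sameCycle_of_fix_le {u v : W m} (h : fix v ≤ fix u) {i j : Fin (m + 1)}
    (hij : SameCycle u i j) : SameCycle v i j := by
  rw [← relOf_fix] at hij ⊢
  exact fun x hx => hij x (h hx)

lemma sameCycle_of_dimFix {c : W m} (hc : dimFix c = 0) (i j : Fin (m + 1)) :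
    SameCycle c i j := by
  rw [← relOf_fix]
  intro x hx
  rw [dimFix, Submodule.finrank_eq_zero] at hc
  rw [hc, Submodule.mem_bot] at hx
  rw [hx]; rfl

/-- In `c * swap a a' = (c * v⁻¹) * (v * swap a a')` both `c` and `v` gain one dimension, so
codimensions still add up and every cycle of `v * swap a a'` lies in a cycle of `c * swap a a'`. -/
lemma sameCycle_mul_swap_of_under {c v : W m} (hc : dimFix c = 0) (hv : Under c v)
    {a a' : Fin (m + 1)} (ha : SameCycle v a a') (hne : a ≠ a') {x y : Fin (m + 1)}
    (hxy : SameCycle (v * swap a a') x y) : SameCycle (c * swap a a') x y := by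
  refine sameCycle_of_fix_le ?_ hxy
  have h1 := dimFix_mul_swap_of_sameCycle ha hne
  have h2 := dimFix_mul_swap_of_sameCycle (sameCycle_of_dimFix hc a a') hne
  have h3 : c * swap a a' = (c * v⁻¹) * (v * swap a a') := by group
  have h4 : dimFix (c * v⁻¹ * (v * swap a a')) = 1 := by rw [← h3, h2, hc]
  rw [h3]
  apply fix_le_fix_of_dimFix
  unfold Under at hv
  omega

lemma sameCycle_swap_cross {g : W m} {a a' : Fin (m + 1)} :
    SameCycle (g * swap a a') a (g a') ∧ SameCycle (g * swap a a') a' (g a) := by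
  constructor
  · refine ⟨1, ?_⟩
    rw [zpow_one, Perm.mul_apply, swap_apply_left]
  · refine ⟨1, ?_⟩
    rw [zpow_one, Perm.mul_apply, swap_apply_right]

/-- If `u` and `v` lie below `c`, then a cycle of `v` leaves a cycle of `u` for a given other cycle
of `u` at most once. -/
lemma exit_unique {c u v : W m} (hc : dimFix c = 0) (hu : Under c u) (hv : Under c v)
    {a a' : Fin (m + 1)} (h1 : SameCycle v a a') (h2 : SameCycle u a a')
    (h3 : SameCycle u (v a) (v a')) (h4 : ¬ SameCycle u a (v a)) : a = a' := by
  by_contra hne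
  have hne' : v a ≠ v a' := fun e => hne (v.injective e)
  -- The `u`-cycle containing `v a` and `v a'` avoids `a` and `a'`, so the transposition does not
  -- affect it.
  have hus : SameCycle (u * swap a a') (v a) (v a') := by
    obtain ⟨k, -, hk⟩ := h3.exists_pow_eq'
    have : ∀ k : ℕ, ((u * swap a a') ^ k) (v a) = (u ^ k) (v a) := by
      intro k
      induction k with
      | zero => rfl
      | succ k ih =>
        have hcyc : SameCycle u (v a) ((u ^ k) (v a)) := sameCycle_pow_right.2 (SameCycle.refl u _)
        rw [pow_succ', Perm.mul_apply, ih, Perm.mul_apply, swap_apply_of_ne_of_ne,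
          pow_succ', Perm.mul_apply]
        · intro e
          rw [e] at hcyc
          exact h4 hcyc.symm
        · intro e
          rw [e] at hcyc
          exact h4 (h2.trans hcyc.symm)
    exact ⟨k, by rw [zpow_natCast, this, hk]⟩
  have d1 := dimFix_mul_swap_of_sameCycle h2 hne
  have d2 := dimFix_mul_swap_of_sameCycle hus hne'
  have d3 := dimFix_mul_swap_of_sameCycle (sameCycle_of_dimFix hc a a') hne
  -- Otherwise multiplying by `swap (v a) (v a')` would bring `c * swap a a'` back to dimension `0`,
  -- while `u * swap a a'` gains a second dimension, against subadditivity of codimensions.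
  have hcs : SameCycle (c * swap a a') (v a) (v a') := by
    by_contra hn
    have d4 := dimFix_mul_swap hn
    have d5 := dimFix_add_le (c * u⁻¹) (u * swap a a' * swap (v a) (v a'))
    have e : c * u⁻¹ * (u * swap a a' * swap (v a) (v a')) = c * swap a a' * swap (v a) (v a') := by
      group
    rw [e] at d5
    unfold Under at hu
    omega
  -- In `c * swap a a'` the cycles of `a` and `v a'` agree, and so do those of `a'` and `v a`. With
  -- `hcs` this puts `a` and `a'` in one cycle, although the transposition has separated them.
  obtain ⟨e1, e2⟩ := sameCycle_swap_cross (g := v) (a := a) (a' := a')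
  have e1 := sameCycle_mul_swap_of_under hc hv h1 hne e1
  have e2 := sameCycle_mul_swap_of_under hc hv h1 hne e2
  exact not_sameCycle_mul_swap (sameCycle_of_dimFix hc a a') hne
    ((e1.trans hcs.symm).trans e2.symm)

/-- Every initial segment of `Fin (m + 1)` is left at most once by `c`. -/
def CutProperty (c : W m) : Prop :=
  ∀ t x y : Fin (m + 1), x ≤ t → y ≤ t → t < c x → t < c y → x = y

lemma exists_exit {g : W m} {t x y : Fin (m + 1)} (h : SameCycle g x y) (hx : x ≤ t)
    (hy : t < y) : ∃ z, SameCycle g x z ∧ z ≤ t ∧ t < g z := by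
  by_contra! hall
  obtain ⟨k, -, rfl⟩ := h.exists_pow_eq'
  have : ∀ k : ℕ, (g ^ k) x ≤ t := by
    intro k
    induction k with
    | zero => exact hx
    | succ k ih =>
      rw [pow_succ', Perm.mul_apply]
      exact hall _ (sameCycle_pow_right.2 (SameCycle.refl g _)) ih
  exact absurd hy (not_lt.2 (this k))

/-- The cut property is inherited by the cycles of an element below `c`. -/
lemma exit_unique_of_cutProperty {c v : W m} (hc : dimFix c = 0) (hcut : CutProperty c)
    (hv : Under c v) {t a a' : Fin (m + 1)} (h : SameCycle v a a') (ha : a ≤ t) (ha' : a' ≤ t)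
    (hva : t < v a) (hva' : t < v a') : a = a' := by
  by_contra hne
  obtain ⟨e1, e2⟩ := sameCycle_swap_cross (g := v) (a := a) (a' := a')
  have e1 := sameCycle_mul_swap_of_under hc hv h hne e1
  have e2 := sameCycle_mul_swap_of_under hc hv h hne e2
  -- The cycles of `a` and `a'` under `c * swap a a'` are distinct and both leave `{i ≤ t}`. As
  -- `swap a a'` preserves this set, `c` would leave it at two points.
  obtain ⟨z, hz1, hz2, hz3⟩ := exists_exit e1 ha hva'
  obtain ⟨z', hz1', hz2', hz3'⟩ := exists_exit e2 ha' hva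
  have hs : ∀ z, z ≤ t → swap a a' z ≤ t := by
    intro z hz
    by_cases hia : z = a
    · subst hia; rwa [swap_apply_left]
    · by_cases hib : z = a'
      · subst hib; rwa [swap_apply_right]
      · rwa [swap_apply_of_ne_of_ne hia hib]
  have := hcut t _ _ (hs z hz2) (hs z' hz2') hz3 hz3'
  have := (swap a a').injective this
  subst this
  exact not_sameCycle_mul_swap (sameCycle_of_dimFix hc a a') hne (hz1.trans hz1'.symm)

/-! ### Standard Coxeter elements -/

lemma simpleReflection_le_iff {i j : Fin m} (h : j ≠ i) (y : Fin (m + 1)) :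
    simpleReflection j y ≤ i.castSucc ↔ y ≤ i.castSucc := by
  have h' : (j : ℕ) ≠ i := fun e => h (Fin.ext e)
  unfold simpleReflection
  rw [swap_apply_def]
  split_ifs with h1 h2
  · subst h1; simp only [Fin.le_def, Fin.val_succ, Fin.val_castSucc]; omega
  · subst h2; simp only [Fin.le_def, Fin.val_succ, Fin.val_castSucc]; omega
  · rfl

lemma prod_simpleReflection_le_iff {l : List (Fin m)} {i : Fin m} (h : i ∉ l) (y : Fin (m + 1)) :
    (l.map simpleReflection).prod y ≤ i.castSucc ↔ y ≤ i.castSucc := by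
  induction l with
  | nil => rfl
  | cons j l ih =>
    rw [List.mem_cons, not_or] at h
    rw [List.map_cons, List.prod_cons, Perm.mul_apply, simpleReflection_le_iff (Ne.symm h.1),
      ih h.2]

/-- Only the `i`-th simple reflection crosses the cut after `i`, by moving the single point
`i.castSucc` upwards, and it occurs at most once in the word. -/
lemma exit_unique_prod_simpleReflection {l : List (Fin m)} (hl : l.Nodup) {i : Fin m}
    {x y : Fin (m + 1)} (hx : x ≤ i.castSucc) (hy : y ≤ i.castSucc)
    (hx' : i.castSucc < (l.map simpleReflection).prod x)
    (hy' : i.castSucc < (l.map simpleReflection).prod y) : x = y := by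
  induction l with
  | nil => exact absurd hx' (not_lt.2 hx)
  | cons j l ih =>
    rw [List.nodup_cons] at hl
    rw [List.map_cons, List.prod_cons, Perm.mul_apply] at hx' hy'
    by_cases hji : j = i
    · subst hji
      have key : ∀ z, z ≤ j.castSucc →
          j.castSucc < simpleReflection j ((l.map simpleReflection).prod z) →
          (l.map simpleReflection).prod z = j.castSucc := by
        intro z hz hz'
        have h1 := (prod_simpleReflection_le_iff hl.1 z).2 hz
        by_contra hne
        rw [simpleReflection, swap_apply_of_ne_of_ne hne] at hz'
        · exact absurd hz' (not_lt.2 h1)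
        · intro e
          rw [Fin.ext_iff, Fin.val_succ] at e
          rw [Fin.le_def, Fin.val_castSucc] at h1
          omega
      exact ((l.map simpleReflection).prod).injective ((key x hx hx').trans (key y hy hy').symm)
    · rw [← not_le, simpleReflection_le_iff hji, not_le] at hx' hy'
      exact ih hl.2 hx' hy'

open Classical in
lemma eq_of_fix_prod_simpleReflection {l : List (Fin m)} (hl : l.Nodup) {x : Fin (m + 1) → ℝ}
    (hx : ∀ i, x ((l.map simpleReflection).prod i) = x i) {i : Fin m} (hi : i ∈ l) :
    x i.castSucc = x i.succ := by
  induction l with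
  | nil => simp at hi
  | cons j l ih =>
    rw [List.nodup_cons] at hl
    rw [List.map_cons, List.prod_cons] at hx
    set g := (l.map simpleReflection).prod with hg
    let O : Finset (Fin (m + 1)) := Finset.univ.filter fun y => y ≤ j.castSucc
    -- The remaining word `g` preserves `{y ≤ j}`, so summing `x` over this set isolates the effect
    -- of the reflection `j`, which replaces `x j.castSucc` by `x j.succ`.
    have h1 : ∑ y ∈ O, x (simpleReflection j (g y)) = ∑ y ∈ O, x (simpleReflection j y) := by
      refine Finset.sum_bijective g g.bijective ?_ (fun _ _ => rfl)
      intro y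
      simp only [O, Finset.mem_filter, Finset.mem_univ, true_and]
      exact (prod_simpleReflection_le_iff hl.1 y).symm
    have hjO : j.castSucc ∈ O := by simp [O]
    have h2 : ∑ y ∈ O, x (simpleReflection j y) = x j.succ + ∑ y ∈ O.erase j.castSucc, x y := by
      rw [← Finset.add_sum_erase _ _ hjO]
      unfold simpleReflection
      rw [swap_apply_left]
      congr 1
      refine Finset.sum_congr rfl fun y hy => ?_
      rw [swap_apply_of_ne_of_ne (Finset.ne_of_mem_erase hy)]
      rintro rfl
      have := Finset.mem_of_mem_erase hy
      simp [O, Fin.le_def] at this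
    have h3 := Finset.add_sum_erase _ x hjO
    have h4 : ∑ y ∈ O, x (simpleReflection j (g y)) = ∑ y ∈ O, x y :=
      Finset.sum_congr rfl fun y _ => hx y
    have key : x j.castSucc = x j.succ := by linarith
    rcases List.mem_cons.1 hi with rfl | hi
    · exact key
    · refine ih hl.2 (fun y => ?_) hi
      rw [← hx y, Perm.mul_apply]
      unfold simpleReflection
      rw [swap_apply_def]
      split_ifs with e1 e2
      · rw [e1, key]
      · rw [e2, key]
      · rfl

lemma IsStandardCoxeter.exists_list {c : W m} (hc : IsStandardCoxeter c) :
    ∃ l : List (Fin m), l.Nodup ∧ (∀ i, i ∈ l) ∧ c = (l.map simpleReflection).prod := by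
  obtain ⟨σ, rfl⟩ := hc
  refine ⟨List.ofFn σ, List.nodup_ofFn.2 σ.injective, fun i => ?_, ?_⟩
  · exact List.mem_ofFn.2 ⟨σ.symm i, σ.apply_symm_apply i⟩
  · rw [List.map_ofFn]; rfl

lemma IsStandardCoxeter.dimFix_eq_zero {c : W m} (hc : IsStandardCoxeter c) : dimFix c = 0 := by
  obtain ⟨l, h1, h2, rfl⟩ := hc.exists_list
  rw [dimFix, Submodule.finrank_eq_zero, Submodule.eq_bot_iff]
  intro x hx
  rw [mem_fix] at hx
  have h0 : ∀ i, x i = x 0 := by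
    intro i
    induction i using Fin.induction with
    | zero => rfl
    | succ i ih => rw [← eq_of_fix_prod_simpleReflection h1 hx.2 (h2 i), ih]
  have h3 := hx.1
  rw [mem_V, Finset.sum_congr rfl fun i _ => h0 i, Finset.sum_const, Finset.card_univ,
    Fintype.card_fin, nsmul_eq_mul] at h3
  have h4 : x 0 = 0 := by
    rcases mul_eq_zero.1 h3 with h | h
    · exact absurd h (by positivity)
    · exact h
  funext i
  rw [h0, h4]; rfl

lemma IsStandardCoxeter.cutProperty {c : W m} (hc : IsStandardCoxeter c) : CutProperty c := by
  obtain ⟨l, h1, -, rfl⟩ := hc.exists_list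
  intro t x y hx hy hx' hy'
  induction t using Fin.lastCases with
  | last => exact absurd hx' (not_lt.2 (Fin.le_last _))
  | cast i => exact exit_unique_prod_simpleReflection h1 hx hy hx' hy'

end TypeA

/-! ### Chains of mergings -/

namespace TypeA

open Equiv Equiv.Perm

variable {m : ℕ}

/-- `R'` is obtained from `R` by merging the distinct classes of `a` and `b`. -/
def Merges {α : Type*} (R R' : Setoid α) (a b : α) : Prop :=
  ¬ R a b ∧ ∀ i j, R' i j ↔ R i j ∨ ((R a i ∨ R b i) ∧ (R a j ∨ R b j))

namespace Merges

variable {α : Type*} {R R' : Setoid α} {a b : α}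

lemma le (h : Merges R R' a b) : R ≤ R' := fun i j hij => (h.2 i j).2 (Or.inl hij)

lemma rel (h : Merges R R' a b) : R' a b :=
  (h.2 a b).2 (Or.inr ⟨Or.inl (R.refl a), Or.inr (R.refl b)⟩)

lemma rel_left_iff (h : Merges R R' a b) {i : α} : R' a i ↔ R a i ∨ R b i := by
  rw [h.2]
  refine ⟨?_, fun h => Or.inr ⟨Or.inl (R.refl a), h⟩⟩
  rintro (h | h)
  exacts [Or.inl h, h.2]

lemma rel_iff_of_not (h : Merges R R' a b) {i j : α} (hi : ¬ R' a i) : R' i j ↔ R i j := by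
  rw [h.rel_left_iff] at hi
  rw [h.2]
  tauto

lemma not_rel_both (h : Merges R R' a b) {i : α} (h1 : R a i) (h2 : R b i) : False :=
  h.1 (R.trans h1 (R.symm h2))

lemma comap (h : Merges R R' a b) (w : Perm α) :
    Merges (R.comap ⇑w⁻¹) (R'.comap ⇑w⁻¹) (w a) (w b) := by
  refine ⟨?_, fun i j => ?_⟩
  · rw [Setoid.comap_rel, inv_apply_apply, inv_apply_apply]
    exact h.1
  · simp only [Setoid.comap_rel, inv_apply_apply]
    exact h.2 _ _

end Merges

/-- The equivalence relation obtained by merging the classes of `a` and `b`. -/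
def mergeSetoid {α : Type*} (R : Setoid α) (a b : α) : Setoid α where
  r i j := R i j ∨ ((R a i ∨ R b i) ∧ (R a j ∨ R b j))
  iseqv := by
    refine ⟨fun i => Or.inl (R.refl i), ?_, ?_⟩
    · rintro i j (h | h)
      exacts [Or.inl (R.symm h), Or.inr h.symm]
    · rintro i j k (h | ⟨h1, h2⟩) (h' | ⟨h1', h2'⟩)
      · exact Or.inl (R.trans h h')
      · exact Or.inr ⟨h1'.imp (fun e => R.trans e (R.symm h)) fun e => R.trans e (R.symm h), h2'⟩
      · exact Or.inr ⟨h1, h2.imp (fun e => R.trans e h') fun e => R.trans e h'⟩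
      · exact Or.inr ⟨h1, h2'⟩

section Subspaces

variable {R R' : Setoid (Fin (m + 1))} {a b : Fin (m + 1)}

lemma Merges.subOf_eq (h : Merges R R' a b) : subOf R' = subOf R ⊓ hyp a b := by
  ext x
  rw [Submodule.mem_inf, mem_hyp]
  refine ⟨fun hx => ⟨subOf_le_subOf.2 h.le hx, hx.2 _ _ h.rel⟩, ?_⟩
  rintro ⟨⟨hV, hx⟩, hab⟩
  refine ⟨hV, fun i j hij => ?_⟩
  have key : ∀ i, R a i ∨ R b i → x i = x a := by
    rintro i (hi | hi)
    · exact (hx _ _ hi).symm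
    · rw [hab, hx _ _ hi]
  rcases (h.2 i j).1 hij with h | h
  · exact hx i j h
  · rw [key i h.1, key j h.2]

lemma Merges.subOf_lt (h : Merges R R' a b) : subOf R' < subOf R := by
  refine lt_of_le_of_ne (subOf_le_subOf.2 h.le) fun e => h.1 ?_
  rw [← subOf_injective e]
  exact h.rel

lemma Merges.finrank_subOf (h : Merges R R' a b) :
    Module.finrank ℝ (subOf R') + 1 = Module.finrank ℝ (subOf R) := by
  have h1 := finrank_inf_hyp (subOf R) a b
  have h2 := Submodule.finrank_lt_finrank_of_lt h.subOf_lt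
  rw [← h.subOf_eq] at h1
  omega

/-- Merging any two classes that `R'` identifies and `R` does not already costs the one available
dimension, so nothing else can be identified. -/
lemma exists_merges (hlt : subOf R' < subOf R)
    (hd : Module.finrank ℝ (subOf R) ≤ Module.finrank ℝ (subOf R') + 1) :
    ∃ a b, Merges R R' a b := by
  have hle : R ≤ R' := subOf_le_subOf.1 hlt.le
  obtain ⟨a, b, h1, h2⟩ : ∃ a b, R' a b ∧ ¬ R a b := by
    by_contra! hall
    exact hlt.ne (congrArg subOf (le_antisymm (fun i j => hall i j) hle))
  have hM : Merges R (mergeSetoid R a b) a b := ⟨h2, fun _ _ => Iff.rfl⟩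
  have h3 : subOf R' ≤ subOf (mergeSetoid R a b) := by
    rw [hM.subOf_eq]
    exact le_inf hlt.le fun x hx => mem_hyp.2 (hx.2 _ _ h1)
  have h4 := hM.finrank_subOf
  have h5 := subOf_injective (Submodule.eq_of_le_of_finrank_le h3 (by omega))
  exact ⟨a, b, by rw [h5]; exact hM⟩

end Subspaces

/-- A chain of equivalence relations from equality to the full relation, each obtained from its
predecessor by merging the classes of `x j` and `y j`. -/
structure IsMergeChain (R : Fin (m + 1) → Setoid (Fin (m + 1))) (x y : Fin m → Fin (m + 1)) :
    Prop where
  zero : R 0 = ⊥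
  last : R (Fin.last m) = ⊤
  step : ∀ j : Fin m, Merges (R j.castSucc) (R j.succ) (x j) (y j)

lemma subOf_top : subOf (⊤ : Setoid (Fin (m + 1))) = ⊥ := by
  rw [Submodule.eq_bot_iff]
  rintro x ⟨hV, hx⟩
  have h0 : ∀ i, x i = x 0 := fun i => hx i 0 trivial
  rw [mem_V, Finset.sum_congr rfl fun i _ => h0 i, Finset.sum_const, Finset.card_univ,
    Fintype.card_fin, nsmul_eq_mul] at hV
  have h4 : x 0 = 0 := by
    rcases mul_eq_zero.1 hV with h | h
    · exact absurd h (by positivity)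
    · exact h
  funext i
  rw [h0, h4]; rfl

lemma subOf_bot : subOf (⊥ : Setoid (Fin (m + 1))) = V m := by
  ext x
  refine ⟨fun h => h.1, fun h => ⟨h, fun i j hij => ?_⟩⟩
  rw [show i = j from hij]

lemma subOf_relOf_of_mem_noncrossing {c : W m} {L : Sub m} (h : L ∈ noncrossing c) :
    subOf (relOf L) = L := by
  obtain ⟨-, u, -, rfl⟩ := h
  exact subOf_relOf_fix u

lemma bot_mem_noncrossing {c : W m} (hc : dimFix c = 0) : (⊥ : Sub m) ∈ noncrossing c := by
  rw [mem_noncrossing_iff hc]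
  refine ⟨c, ?_, ?_⟩
  · rw [Under, mul_inv_cancel, hc, dimFix, fix_one, finrank_V, add_zero]
  · rw [dimFix, Submodule.finrank_eq_zero] at hc
    exact hc.symm

lemma noncrossing_of_mem_ncChains {c : W m} (hc : dimFix c = 0) {P : Fin (m + 1) → Sub m}
    (hP : P ∈ ncChains c) (i : Fin (m + 1)) : P i ∈ noncrossing c := by
  induction i using Fin.lastCases with
  | last => rw [hP.2.1]; exact bot_mem_noncrossing hc
  | cast i => exact (hP.2.2 i).1

/-- The dimension falls strictly from `m` to `0` in `m` steps, hence by exactly one at each step: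
`h1` and `h2` bound it from the two ends of the chain. -/
lemma exists_isMergeChain {c : W m} (hc : dimFix c = 0) {P : Fin (m + 1) → Sub m}
    (hP : P ∈ ncChains c) :
    ∃ R x y, IsMergeChain R x y ∧ P = fun i => subOf (R i) := by
  have hPR : ∀ i, subOf (relOf (P i)) = P i := fun i =>
    subOf_relOf_of_mem_noncrossing (noncrossing_of_mem_ncChains hc hP i)
  have hlt : ∀ j : Fin m, P j.succ < P j.castSucc := fun j => (hP.2.2 j).2.2.1
  have h1 : ∀ i, Module.finrank ℝ (P i) + i ≤ m := by
    intro i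
    induction i using Fin.induction with
    | zero => rw [hP.1, finrank_V]; simp
    | succ i ih =>
      have := Submodule.finrank_lt_finrank_of_lt (hlt i)
      simp only [Fin.val_succ, Fin.val_castSucc] at ih ⊢
      omega
  have h2 : ∀ i, m ≤ Module.finrank ℝ (P i) + i := by
    intro i
    induction i using Fin.reverseInduction with
    | last => simp
    | cast i ih =>
      have := Submodule.finrank_lt_finrank_of_lt (hlt i)
      simp only [Fin.val_succ, Fin.val_castSucc] at ih ⊢
      omega
  have h3 : ∀ j : Fin m, ∃ a b, Merges (relOf (P j.castSucc)) (relOf (P j.succ)) a b := by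
    intro j
    refine exists_merges ?_ ?_
    · rw [hPR, hPR]; exact hlt j
    · rw [hPR, hPR]
      have e1 := h1 j.castSucc
      have e2 := h2 j.succ
      simp only [Fin.val_succ, Fin.val_castSucc] at e1 e2
      omega
  choose x y hxy using h3
  refine ⟨fun i => relOf (P i), x, y, ⟨?_, ?_, hxy⟩, funext fun i => (hPR i).symm⟩
  · apply subOf_injective
    rw [hPR, hP.1, subOf_bot]
  · apply subOf_injective
    rw [hPR, hP.2.1, subOf_top]

lemma IsMergeChain.comap {R : Fin (m + 1) → Setoid (Fin (m + 1))} {x y : Fin m → Fin (m + 1)}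
    (h : IsMergeChain R x y) (w : W m) :
    IsMergeChain (fun i => (R i).comap ⇑w⁻¹) (w ∘ x) (w ∘ y) := by
  refine ⟨?_, ?_, fun j => (h.step j).comap w⟩
  · ext i j
    rw [Setoid.comap_rel, h.zero]
    exact (w⁻¹).injective.eq_iff
  · ext i j
    rw [Setoid.comap_rel, h.last]
    exact Iff.rfl

/-- The cover condition is automatic, since no subspace fits strictly between two whose dimensions
differ by one. -/
lemma IsMergeChain.mem_ncChains_iff {c : W m} (hc : dimFix c = 0)
    {R : Fin (m + 1) → Setoid (Fin (m + 1))} {x y : Fin m → Fin (m + 1)}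
    (h : IsMergeChain R x y) :
    (fun i => subOf (R i)) ∈ ncChains c ↔ ∀ j : Fin m, subOf (R j.castSucc) ∈ noncrossing c := by
  refine ⟨fun hP j => (hP.2.2 j).1, fun hall => ?_⟩
  have hall' : ∀ i, subOf (R i) ∈ noncrossing c := by
    intro i
    induction i using Fin.lastCases with
    | last => rw [h.last, subOf_top]; exact bot_mem_noncrossing hc
    | cast i => exact hall i
  refine ⟨?_, ?_, fun j => ⟨hall j, hall' _, (h.step j).subOf_lt, ?_⟩⟩
  · simp only [h.zero, subOf_bot]
  · simp only [h.last, subOf_top]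
  · rintro K - ⟨h1, h2⟩
    have e1 := Submodule.finrank_lt_finrank_of_lt h1
    have e2 := Submodule.finrank_lt_finrank_of_lt h2
    have e3 := (h.step j).finrank_subOf
    dsimp only at e1 e2
    omega

/-! ### Noncrossing splittings and interval refinement for one merging -/

section Local

variable {R R' : Setoid (Fin (m + 1))} {a b : Fin (m + 1)}

open Classical in
/-- The class of `a` as a finite set. -/
noncomputable def cls (R : Setoid (Fin (m + 1))) (a : Fin (m + 1)) : Finset (Fin (m + 1)) :=
  Finset.univ.filter fun i => R a i

@[simp] lemma mem_cls {i : Fin (m + 1)} : i ∈ cls R a ↔ R a i := by simp [cls]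

lemma self_mem_cls : a ∈ cls R a := mem_cls.2 (R.refl a)

lemma cls_comap (w : W m) : cls (R.comap ⇑w⁻¹) (w a) = (cls R a).map w.toEmbedding := by
  ext i
  rw [mem_cls, Setoid.comap_rel, inv_apply_apply, Finset.mem_map_equiv, mem_cls]
  rfl

lemma Merges.cls_union (h : Merges R R' a b) : cls R a ∪ cls R b = cls R' a := by
  ext i
  rw [Finset.mem_union, mem_cls, mem_cls, mem_cls, h.rel_left_iff]

lemma Merges.disjoint_cls (h : Merges R R' a b) : Disjoint (cls R a) (cls R b) :=
  Finset.disjoint_left.2 fun _ h1 h2 => h.not_rel_both (mem_cls.1 h1) (mem_cls.1 h2)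

lemma Merges.sdiff_cls (h : Merges R R' a b) : cls R' a \ cls R a = cls R b := by
  rw [← h.cls_union, Finset.union_sdiff_cancel_left h.disjoint_cls]

/-- The elements of `A` sent into `B` by `v`. -/
def exits {α : Type*} [DecidableEq α] (v : Perm α) (A B : Finset α) : Finset α :=
  A.filter fun i => v i ∈ B

/-- A bijection of `A ∪ B` sends as many elements from `A` to `B` as from `B` to `A`. -/
lemma card_exits_comm {α : Type*} [DecidableEq α] {v : Perm α} {A B C : Finset α}
    (hAB : Disjoint A B) (hC : A ∪ B = C) (hv : ∀ i, v i ∈ C ↔ i ∈ C) :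
    (exits v A B).card = (exits v B A).card := by
  subst hC
  have hv' := fun i => hv i
  simp only [Finset.mem_union] at hv'
  have hd := Finset.disjoint_left.1 hAB
  have h1 : exits v A B = A \ A.map v.symm.toEmbedding := by
    ext i
    have := hv' i
    have := @hd (v i)
    simp only [exits, Finset.mem_filter, Finset.mem_sdiff, Finset.mem_map_equiv, symm_symm]
    tauto
  have h2 : exits v B A = A.map v.symm.toEmbedding \ A := by
    ext i
    have := hv' i
    have := @hd i
    simp only [exits, Finset.mem_filter, Finset.mem_sdiff, Finset.mem_map_equiv, symm_symm]
    tauto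
  rw [h1, h2]
  exact Finset.card_sdiff_comm (Finset.card_map _).symm

lemma exists_mem_exits {α : Type*} [DecidableEq α] {v : Perm α} {A B : Finset α}
    (hv : ∀ i ∈ A, v i ∈ A ∪ B) {a b : α} [Finite α] (ha : a ∈ A) (hb : b ∉ A)
    (h : SameCycle v a b) : (exits v A B).Nonempty := by
  by_contra hne
  rw [Finset.not_nonempty_iff_eq_empty, exits, Finset.filter_eq_empty_iff] at hne
  have : ∀ k : ℕ, (v ^ k) a ∈ A := by
    intro k
    induction k with
    | zero => exact ha
    | succ k ih =>
      rw [pow_succ', Perm.mul_apply]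
      exact (Finset.mem_union.1 (hv _ ih)).resolve_right (hne ih)
  obtain ⟨k, -, rfl⟩ := h.exists_pow_eq'
  exact hb (this k)

/-- Splitting a cycle of an element below `c` yields a noncrossing partition exactly when the
parts are arcs of the cycle. -/
lemma Merges.mem_noncrossing_iff {c v : W m} (hc : dimFix c = 0) (h : Merges R R' a b)
    (hv : Under c v) (hR' : subOf R' = fix v) :
    subOf R ∈ noncrossing c ↔ (exits v (cls R a) (cls R b)).card ≤ 1 := by
  have hs : ∀ i j, R' i j ↔ SameCycle v i j := by
    intro i j
    rw [← relOf_fix, ← hR', relOf_subOf]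
  have hvR : ∀ i, R' i (v i) := fun i => (hs _ _).2 (sameCycle_apply_right.2 (SameCycle.refl v i))
  constructor
  · intro hL
    obtain ⟨u, hu, hR⟩ := (TypeA.mem_noncrossing_iff hc).1 hL
    have hs' : ∀ i j, R i j ↔ SameCycle u i j := by
      intro i j
      rw [← relOf_fix, ← hR, relOf_subOf]
    refine Finset.card_le_one.2 fun p hp q hq => ?_
    simp only [exits, Finset.mem_filter, mem_cls] at hp hq
    have hpq := R.trans (R.symm hp.1) hq.1
    refine exit_unique hc hu hv ((hs _ _).1 (h.le hpq)) ((hs' _ _).1 hpq)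
      ((hs' _ _).1 (R.trans (R.symm hp.2) hq.2)) fun e => ?_
    exact h.not_rel_both (R.trans hp.1 ((hs' _ _).2 e)) hp.2
  · intro hcard
    have hinv : ∀ i, v i ∈ cls R' a ↔ i ∈ cls R' a := by
      intro i
      rw [mem_cls, mem_cls]
      exact ⟨fun e => R'.trans e (R'.symm (hvR i)), fun e => R'.trans e (hvR i)⟩
    have hcard' := hcard
    rw [card_exits_comm h.disjoint_cls h.cls_union hinv] at hcard'
    have hab : SameCycle v a b := (hs _ _).1 h.rel
    obtain ⟨z, hz⟩ : (exits v (cls R a) (cls R b)).Nonempty := by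
      refine exists_mem_exits (fun i hi => ?_) self_mem_cls (fun e => h.1 (mem_cls.1 e)) hab
      rw [h.cls_union, hinv, ← h.cls_union]
      exact Finset.mem_union_left _ hi
    obtain ⟨z', hz'⟩ : (exits v (cls R b) (cls R a)).Nonempty := by
      refine exists_mem_exits (fun i hi => ?_) self_mem_cls
        (fun e => h.1 (R.symm (mem_cls.1 e))) hab.symm
      rw [Finset.union_comm, h.cls_union, hinv, ← h.cls_union]
      exact Finset.mem_union_right _ hi
    have hzu := fun i hi => Finset.card_le_one.1 hcard i hi z hz
    have hzu' := fun i hi => Finset.card_le_one.1 hcard' i hi z' hz'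
    simp only [exits, Finset.mem_filter, mem_cls] at hz hz' hzu hzu'
    have hne : z ≠ z' := by
      rintro rfl
      exact h.not_rel_both hz.1 hz'.1
    have hzz : SameCycle v z z' :=
      (hs _ _).1 (R'.trans (R'.symm (h.le hz.1)) (R'.trans h.rel (h.le hz'.1)))
    rw [TypeA.mem_noncrossing_iff hc]
    -- With `z` the only exit from the class of `a` and `z'` the only exit from that of `b`,
    -- exchanging their images makes both classes stable; dimensions then show that they are exactly
    -- the two new cycles.
    refine ⟨v * swap z z', hv.mul_swap hc hzz hne, ?_⟩
    apply Submodule.eq_of_le_of_finrank_le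
    · intro x hx
      refine mem_fix.2 ⟨hx.1, fun i => (hx.2 _ _ ?_).symm⟩
      rw [Perm.mul_apply]
      by_cases e1 : i = z
      · subst e1
        rw [swap_apply_left]
        exact R.trans (R.symm hz.1) hz'.2
      · by_cases e2 : i = z'
        · subst e2
          rw [swap_apply_right]
          exact R.trans (R.symm hz'.1) hz.2
        · rw [swap_apply_of_ne_of_ne e1 e2]
          rcases (h.2 _ _).1 (hvR i) with e | ⟨e3 | e3, e4 | e4⟩
          · exact e
          · exact R.trans (R.symm e3) e4
          · exact absurd (hzu i ⟨e3, e4⟩) e1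
          · exact absurd (hzu' i ⟨e3, e4⟩) e2
          · exact R.trans (R.symm e3) e4
    · have h1 := dimFix_mul_swap_of_sameCycle hzz hne
      have h2 := h.finrank_subOf
      unfold dimFix at h1
      rw [hR'] at h2
      omega

/-- One of the two sets lies entirely to the left of the other. -/
def Separated {α : Type*} [LT α] (A B : Finset α) : Prop :=
  (∀ i ∈ A, ∀ j ∈ B, i < j) ∨ (∀ i ∈ A, ∀ j ∈ B, j < i)

lemma mem_posRootsOf_subOf {i j : Fin (m + 1)} (hij : i < j) :
    (Pi.single i 1 - Pi.single j 1 : Fin (m + 1) → ℝ) ∈ posRootsOf (subOf R) ↔ R i j := by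
  have : ∀ x : Fin (m + 1) → ℝ,
      dotProduct (Pi.single i 1 - Pi.single j 1 : Fin (m + 1) → ℝ) x = x i - x j := by
    intro x
    rw [sub_dotProduct, single_dotProduct, single_dotProduct, one_mul, one_mul]
  rw [← relOf_subOf R, relOf_iff, relOf_subOf]
  simp only [posRootsOf, Set.mem_ofPred_eq, this, sub_eq_zero]
  exact ⟨fun h => h.2, fun h => ⟨⟨i, j, hij, rfl⟩, h⟩⟩

/-- Two positive roots add up to a root only by telescoping, so the simple roots join consecutive
elements of a block. -/
lemma mem_simpleRootsOf_subOf {i j : Fin (m + 1)} (hij : i < j) :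
    (Pi.single i 1 - Pi.single j 1 : Fin (m + 1) → ℝ) ∈ simpleRootsOf (subOf R) ↔
      R i j ∧ ∀ k, i < k → k < j → ¬ R i k := by
  simp only [simpleRootsOf, Set.mem_ofPred_eq, mem_posRootsOf_subOf hij]
  refine and_congr_right fun hR => ⟨fun h k hik hkj hk => ?_, fun h => ?_⟩
  · refine h _ ((mem_posRootsOf_subOf hik).2 hk) _
      ((mem_posRootsOf_subOf hkj).2 (R.trans (R.symm hk) hR)) ?_
    abel
  · intro β hβ γ hγ e
    obtain ⟨p, q, hpq, rfl⟩ := hβ.1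
    obtain ⟨r, s, hrs, rfl⟩ := hγ.1
    rw [mem_posRootsOf_subOf hpq] at hβ
    rw [mem_posRootsOf_subOf hrs] at hγ
    have e' : ∀ l, (if l = i then (1 : ℝ) else 0) - (if l = j then 1 else 0) =
        (if l = p then 1 else 0) - (if l = q then 1 else 0) +
        ((if l = r then 1 else 0) - (if l = s then 1 else 0)) := by
      intro l
      have := congrFun e l
      simpa only [Pi.add_apply, Pi.sub_apply, Pi.single_apply] using this
    -- The coordinates of `e` are compared. If `q = r` the sum telescopes to `e_p - e_s`; otherwise
    -- the entries at `q` and `r` cannot both survive unless `q = j`, `r = i`, and then the entry at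
    -- `s` must cancel that at `p`.
    have key : (p = i ∧ q = r ∧ s = j) ∨ (r = i ∧ s = p ∧ q = j) := by
      have ite01 : ∀ (φ : Prop) [Decidable φ], (if φ then (1 : ℝ) else 0) = 0 ∨
          (if φ then (1 : ℝ) else 0) = 1 := fun φ _ => by split_ifs <;> simp
      by_cases hqr : q = r
      · subst hqr
        have hps := hpq.trans hrs
        have h4 := e' s
        rw [if_neg hps.ne', if_neg hrs.ne', if_pos rfl] at h4
        have hsj : s = j := by
          by_contra hne
          rw [if_neg hne] at h4
          rcases ite01 (s = i) with e | e <;> rw [e] at h4 <;> norm_num at h4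
        subst hsj
        have h1 := e' p
        rw [if_neg hps.ne, if_neg hpq.ne, if_pos rfl] at h1
        refine Or.inl ⟨?_, rfl, rfl⟩
        by_contra hne
        rw [if_neg hne] at h1
        norm_num at h1
      · have h2 := e' q
        rw [if_neg hpq.ne', if_pos rfl, if_neg hqr] at h2
        have hqj : q = j := by
          by_contra hne
          rw [if_neg hne] at h2
          rcases ite01 (q = i) with e | e <;> rcases ite01 (q = s) with e1 | e1 <;>
            rw [e, e1] at h2 <;> norm_num at h2
        subst hqj
        have h3 := e' r
        rw [if_neg (Ne.symm hqr), if_pos rfl, if_neg hrs.ne] at h3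
        have hri : r = i := by
          by_contra hne
          rw [if_neg hne] at h3
          rcases ite01 (r = p) with e | e <;> rw [e] at h3 <;> norm_num at h3
        subst hri
        have h4 := e' s
        rw [if_neg hrs.ne', if_pos rfl] at h4
        refine Or.inr ⟨rfl, ?_, rfl⟩
        by_contra hne
        rw [if_neg hne] at h4
        rcases ite01 (s = q) with e | e <;> rw [e] at h4 <;> norm_num at h4
    rcases key with ⟨rfl, rfl, rfl⟩ | ⟨rfl, rfl, rfl⟩
    · exact h _ hpq hrs hβ
    · exact h _ hrs hpq hγ

/-- Interval refinement of a merging: the two parts are separated. -/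
lemma Merges.intervalRefinement_iff (h : Merges R R' a b) :
    IntervalRefinement (subOf R) (subOf R') ↔ Separated (cls R a) (cls R b) := by
  have hIR : IntervalRefinement (subOf R) (subOf R') ↔ ∀ i j, i < j → R i j →
      (∀ k, i < k → k < j → ¬ R i k) → ∀ k, i < k → k < j → ¬ R' i k := by
    constructor
    · intro hIR i j hij hR hk
      exact ((mem_simpleRootsOf_subOf hij).1
        (hIR ((mem_simpleRootsOf_subOf hij).2 ⟨hR, hk⟩))).2
    · intro hall α hα
      obtain ⟨i, j, hij, rfl⟩ := hα.1.1
      obtain ⟨h1, h2⟩ := (mem_simpleRootsOf_subOf hij).1 hα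
      exact (mem_simpleRootsOf_subOf hij).2 ⟨h.le h1, hall i j hij h1 h2⟩
  rw [hIR]
  constructor
  · intro hall
    -- If an element `q` of the other part lay to the left of some `p'`, the neighbours of `q` in
    -- `cls R a` on both sides would be consecutive there but no longer in the merged block.
    have main : ∀ {a b : Fin (m + 1)}, Merges R R' a b →
        (∃ p ∈ cls R a, ∀ q ∈ cls R b, p < q) → ∀ p ∈ cls R a, ∀ q ∈ cls R b, p < q := by
      rintro a b h ⟨p0, hp0, hlt⟩ p' hp' q hq
      by_contra hn
      have hne : p' ≠ q := by
        rintro rfl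
        exact Finset.disjoint_left.1 h.disjoint_cls hp' hq
      have hqp : q < p' := lt_of_le_of_ne (not_lt.1 hn) (Ne.symm hne)
      obtain ⟨i, hi, hi'⟩ := Finset.exists_max_image ((cls R a).filter (· < q)) id
        ⟨p0, Finset.mem_filter.2 ⟨hp0, hlt q hq⟩⟩
      obtain ⟨j, hj, hj'⟩ := Finset.exists_min_image ((cls R a).filter (q < ·)) id
        ⟨p', Finset.mem_filter.2 ⟨hp', hqp⟩⟩
      simp only [Finset.mem_filter, mem_cls, id] at hi hi' hj hj' hp0 hp' hq
      refine hall i j (hi.2.trans hj.2) (R.trans (R.symm hi.1) hj.1) ?_ q hi.2 hj.2 ?_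
      · intro k hik hkj hk
        have hk' := R.trans hi.1 hk
        rcases lt_trichotomy k q with e | rfl | e
        · exact absurd hik (not_lt.2 (hi' k ⟨hk', e⟩))
        · exact h.not_rel_both hk' hq
        · exact absurd hkj (not_lt.2 (hj' k ⟨hk', e⟩))
      · exact R'.trans (R'.symm (h.le hi.1)) (R'.trans h.rel (h.le hq))
    have hsymm : Merges R R' b a := ⟨fun e => h.1 (R.symm e), fun i j => by
      rw [h.2, or_comm (a := R a i), or_comm (a := R a j)]⟩
    obtain ⟨p, hp, hp'⟩ := Finset.exists_min_image (cls R a) id ⟨a, self_mem_cls⟩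
    obtain ⟨q, hq, hq'⟩ := Finset.exists_min_image (cls R b) id ⟨b, self_mem_cls⟩
    have hne : p ≠ q := by
      rintro rfl
      exact Finset.disjoint_left.1 h.disjoint_cls hp hq
    rcases lt_or_gt_of_ne hne with e | e
    · exact Or.inl (main h ⟨p, hp, fun i hi => e.trans_le (hq' i hi)⟩)
    · right
      intro i hi j hj
      exact main hsymm ⟨q, hq, fun i hi => e.trans_le (hp' i hi)⟩ j hj i hi
  · intro hsep i j hij hRij hno k hik hkj hk
    have hnk := hno k hik hkj
    have hk' := ((h.2 i k).1 hk).resolve_left hnk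
    simp only [Separated, mem_cls] at hsep
    rcases hk' with ⟨e1 | e1, e2 | e2⟩
    · exact hnk (R.trans (R.symm e1) e2)
    · rcases hsep with hs | hs
      · exact absurd hkj (hs _ (R.trans e1 hRij) _ e2).not_gt
      · exact absurd hik (hs _ e1 _ e2).not_gt
    · rcases hsep with hs | hs
      · exact absurd hik (hs _ e2 _ e1).not_gt
      · exact absurd hkj (hs _ e2 _ (R.trans e1 hRij)).not_gt
    · exact hnk (R.trans (R.symm e1) e2)

end Local

end TypeA

/-! ### Counting the arcs of a cycle -/

namespace TypeA

open Equiv Equiv.Perm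

section Counting

variable {α : Type*}

lemma eq_range_card {S : Finset ℕ} (h : ∀ i, i + 1 ∈ S → i ∈ S) : S = Finset.range S.card := by
  have hd : ∀ j i, i + j ∈ S → i ∈ S := by
    intro j
    induction j with
    | zero => intro i hi; exact hi
    | succ j ih => intro i hi; exact ih i (h _ hi)
  refine Finset.eq_of_subset_of_card_le (fun i hi => ?_) (by rw [Finset.card_range])
  rw [Finset.mem_range, ← Nat.succ_le_iff]
  refine (Finset.card_range (i + 1)).symm.trans_le (Finset.card_le_card fun k hk => ?_)
  rw [Finset.mem_range] at hk
  exact hd (i - k) k (by rwa [Nat.add_sub_cancel' (by omega)])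

/-- The number of arcs of given size of a cycle. -/
lemma card_arcs [DecidableEq α] {v : Perm α} {C : Finset α} (hv : v.IsCycleOn C) {k : ℕ} (hk : 1 ≤ k)
    (hkC : k < C.card) :
    ((C.powersetCard k).filter fun A => (exits v A (C \ A)).card ≤ 1).card = C.card := by
  set N := C.card with hN
  let g : α → ℕ → α := fun e i => (v⁻¹ ^ i) e
  have hv' : v⁻¹.IsCycleOn C := hv.inv
  have hgC : ∀ e ∈ C, ∀ i, g e i ∈ C := by
    intro e he i
    exact (hv'.1.perm_pow i).mapsTo he
  have hginj : ∀ e ∈ C, ∀ i < N, ∀ j < N, g e i = g e j → i = j := by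
    intro e he i hi j hj h
    exact Nat.ModEq.eq_of_lt_of_lt ((hv'.pow_apply_eq_pow_apply he).1 h) hi hj
  have hgsurj : ∀ e ∈ C, ∀ x ∈ C, ∃ i < N, g e i = x := fun e he x hx =>
    hv'.exists_pow_eq he hx
  have hgv : ∀ e i, v (g e (i + 1)) = g e i := by
    intro e i
    simp only [g, pow_succ', Perm.mul_apply, apply_inv_apply]
  have hvC : ∀ x ∈ C, v x ∈ C := fun x hx => hv.1.mapsTo hx
  -- The arc ending at `e`, read backwards along the cycle. Its end is its only exit, which makes
  -- `arc` injective.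
  let arc : α → Finset α := fun e => (Finset.range k).image (g e)
  have harcC : ∀ e ∈ C, arc e ⊆ C := by
    intro e he x hx
    obtain ⟨i, -, rfl⟩ := Finset.mem_image.1 hx
    exact hgC e he i
  have harc : ∀ e ∈ C, exits v (arc e) (C \ arc e) = {e} := by
    intro e he
    ext x
    rw [exits, Finset.mem_filter, Finset.mem_singleton, Finset.mem_sdiff]
    constructor
    · rintro ⟨hx, -, hx'⟩
      obtain ⟨i, hi, rfl⟩ := Finset.mem_image.1 hx
      cases i with
      | zero => rfl
      | succ i =>
        refine absurd (Finset.mem_image.2 ⟨i, ?_, (hgv e i).symm⟩) hx'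
        rw [Finset.mem_range] at hi ⊢
        omega
    · rintro rfl
      refine ⟨Finset.mem_image.2 ⟨0, Finset.mem_range.2 hk, rfl⟩, hvC _ he, fun h => ?_⟩
      obtain ⟨i, hi, hi'⟩ := Finset.mem_image.1 h
      rw [← hgv x i] at hi'
      rw [Finset.mem_range] at hi
      have := hginj x he (i + 1) (by omega) 0 (by omega) (v.injective hi')
      omega
  symm
  refine Finset.card_bij (fun e _ => arc e) ?_ ?_ ?_
  · intro e he
    rw [Finset.mem_filter, Finset.mem_powersetCard, harc e he, Finset.card_singleton]
    refine ⟨⟨harcC e he, ?_⟩, le_rfl⟩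
    rw [Finset.card_image_of_injOn, Finset.card_range]
    intro i hi j hj h
    rw [Finset.mem_coe, Finset.mem_range] at hi hj
    exact hginj e he i (by omega) j (by omega) h
  · intro e he e' he' h
    rw [← Finset.singleton_inj, ← harc e he, ← harc e' he', h]
  · intro A hA
    rw [Finset.mem_filter, Finset.mem_powersetCard] at hA
    obtain ⟨⟨hAC, hAk⟩, hex⟩ := hA
    have hneA : A.Nonempty := by rw [← Finset.card_pos]; omega
    obtain ⟨e, he⟩ : (exits v A (C \ A)).Nonempty := by
      by_contra hne
      rw [Finset.not_nonempty_iff_eq_empty, exits, Finset.filter_eq_empty_iff] at hne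
      obtain ⟨a, ha⟩ := hneA
      have hall : ∀ n : ℕ, (v ^ n) a ∈ A := by
        intro n
        induction n with
        | zero => exact ha
        | succ n ih =>
          rw [pow_succ', Perm.mul_apply]
          by_contra hn
          exact hne ih (Finset.mem_sdiff.2 ⟨hvC _ (hAC ih), hn⟩)
      have : C ⊆ A := by
        intro x hx
        obtain ⟨n, -, rfl⟩ := hv.exists_pow_eq (hAC ha) hx
        exact hall n
      have := Finset.card_le_card this
      omega
    have heu := fun i hi => Finset.card_le_one.1 hex i hi e he
    simp only [exits, Finset.mem_filter, Finset.mem_sdiff] at he heu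
    have heC := hAC he.1
    refine ⟨e, heC, ?_⟩
    let S := (Finset.range N).filter fun i => g e i ∈ A
    have hS : S.image (g e) = A := by
      ext x
      simp only [S, Finset.mem_image, Finset.mem_filter, Finset.mem_range]
      constructor
      · rintro ⟨i, ⟨-, hi⟩, rfl⟩
        exact hi
      · intro hx
        obtain ⟨i, hi, rfl⟩ := hgsurj e heC x (hAC hx)
        exact ⟨i, ⟨hi, hx⟩, rfl⟩
    have hScard : S.card = k := by
      rw [← hAk, ← hS, Finset.card_image_of_injOn]
      intro i hi j hj h
      simp only [S, Finset.coe_filter, Finset.mem_range, Set.mem_ofPred_eq] at hi hj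
      exact hginj e heC i hi.1 j hj.1 h
    -- If `i + 1` were in `S` but not `i`, then `g e (i + 1)` would be an exit from `A` other than
    -- `e`. So `A` is read off from `e` without gaps.
    have := eq_range_card (S := S) (fun i hi => by
      simp only [S, Finset.mem_filter, Finset.mem_range] at hi ⊢
      refine ⟨by omega, ?_⟩
      by_contra hn
      have h1 := heu (g e (i + 1)) ⟨hi.2, by rw [hgv]; exact ⟨hgC e heC i, hn⟩⟩
      have := hginj e heC (i + 1) hi.1 0 (by omega) h1
      omega)
    rw [hScard] at this
    change (Finset.range k).image (g e) = A
    rw [← this, hS]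

variable [LinearOrder α]

lemma exists_initial (C : Finset α) : ∀ k ≤ C.card, ∃ A ∈ C.powersetCard k,
    ∀ i ∈ A, ∀ j ∈ C \ A, i < j := by
  intro k
  induction k with
  | zero => exact fun _ => ⟨∅, by simp, by simp⟩
  | succ k ih =>
    intro hk
    obtain ⟨A, hA, hlt⟩ := ih (by omega)
    rw [Finset.mem_powersetCard] at hA
    have hne : (C \ A).Nonempty := by
      rw [← Finset.card_pos, Finset.card_sdiff_of_subset hA.1]
      omega
    obtain ⟨p, hp, hp'⟩ := Finset.exists_min_image (C \ A) id hne
    rw [Finset.mem_sdiff] at hp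
    refine ⟨insert p A, Finset.mem_powersetCard.2 ⟨Finset.insert_subset hp.1 hA.1, ?_⟩, ?_⟩
    · rw [Finset.card_insert_of_notMem hp.2, hA.2]
    · intro i hi j hj
      rw [Finset.mem_sdiff, Finset.mem_insert, not_or] at hj
      rcases Finset.mem_insert.1 hi with rfl | hi
      · exact lt_of_le_of_ne (hp' j (Finset.mem_sdiff.2 ⟨hj.1, hj.2.2⟩)) (Ne.symm hj.2.1)
      · exact hlt i hi j (Finset.mem_sdiff.2 ⟨hj.1, hj.2.2⟩)

lemma initial_unique {C A A' : Finset α} {k : ℕ} (hA : A ∈ C.powersetCard k)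
    (hA' : A' ∈ C.powersetCard k) (h : ∀ i ∈ A, ∀ j ∈ C \ A, i < j)
    (h' : ∀ i ∈ A', ∀ j ∈ C \ A', i < j) : A = A' := by
  rw [Finset.mem_powersetCard] at hA hA'
  by_contra hne
  have h1 : (A \ A').Nonempty := by
    rw [Finset.nonempty_iff_ne_empty, Ne, Finset.sdiff_eq_empty_iff_subset]
    exact fun e => hne (Finset.eq_of_subset_of_card_le e (by omega))
  have h2 : (A' \ A).Nonempty := by
    rw [Finset.nonempty_iff_ne_empty, Ne, Finset.sdiff_eq_empty_iff_subset]
    exact fun e => hne (Finset.eq_of_subset_of_card_le e (by omega)).symm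
  obtain ⟨p, hp⟩ := h1
  obtain ⟨q, hq⟩ := h2
  rw [Finset.mem_sdiff] at hp hq
  exact lt_asymm (h p hp.1 q (Finset.mem_sdiff.2 ⟨hA'.1 hq.1, hq.2⟩))
    (h' q hq.1 p (Finset.mem_sdiff.2 ⟨hA.1 hp.1, hp.2⟩))

open Polynomial Classical in
/-- The weight of a part `A` of a cycle `C` of `v`. -/
noncomputable def arcWeight (v : Perm α) (C A : Finset α) : ℤ[X] :=
  if (C.card = 2 → ∀ i ∈ A, ∀ j ∈ C \ A, i < j) ∧ (exits v A (C \ A)).card ≤ 1 then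
    X ^ (if Separated A (C \ A) then 0 else 1) else 0

open Polynomial Classical in
lemma sum_arcWeight {v : Perm α} {C : Finset α} (hv : v.IsCycleOn C)
    (hcut : ∀ A ⊆ C, (∀ i ∈ A, ∀ j ∈ C \ A, i < j) → (exits v A (C \ A)).card ≤ 1)
    {k : ℕ} (hk : 1 ≤ k) (hkC : k < C.card) :
    ∑ A ∈ C.powersetCard k, arcWeight v C A =
      if C.card = 2 then 1 else 2 + X * Polynomial.C ((C.card : ℤ) - 2) := by
  obtain ⟨I, hI, hIlt⟩ := exists_initial C k hkC.le
  obtain ⟨J', hJ', hJlt⟩ := exists_initial C (C.card - k) (by omega)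
  have hIC := Finset.mem_powersetCard.1 hI
  have hJC' := Finset.mem_powersetCard.1 hJ'
  split_ifs with h2
  -- In a block of size two the normalization admits only the initial segment, and it is separated
  -- from its complement.
  · rw [Finset.sum_eq_single I]
    · rw [arcWeight, if_pos ⟨fun _ => hIlt, hcut I hIC.1 hIlt⟩, if_pos (show Separated I (C \ I) from Or.inl hIlt), pow_zero]
    · intro A hA hne
      rw [arcWeight, if_neg]
      rintro ⟨h, -⟩
      exact hne (initial_unique hA hI (h h2) hIlt)
    · exact fun h => absurd hI h
  · set F := (C.powersetCard k).filter fun A => (exits v A (C \ A)).card ≤ 1 with hF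
    have hFcard : F.card = C.card := card_arcs hv hk hkC
    set J := C \ J' with hJ
    have hCJ : C \ J = J' := Finset.sdiff_sdiff_eq_self hJC'.1
    have hJk : J ∈ C.powersetCard k := by
      refine Finset.mem_powersetCard.2 ⟨Finset.sdiff_subset, ?_⟩
      rw [hJ, Finset.card_sdiff_of_subset hJC'.1, hJC'.2]
      omega
    have hvC : ∀ i, v i ∈ C ↔ i ∈ C := fun i => hv.apply_mem_iff
    have hIF : I ∈ F := Finset.mem_filter.2 ⟨hI, hcut I hIC.1 hIlt⟩
    -- The final segment `J` is an arc because its complement is an initial segment and a set has as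
    -- many exits as its complement.
    have hJF : J ∈ F := by
      refine Finset.mem_filter.2 ⟨hJk, ?_⟩
      rw [card_exits_comm Finset.disjoint_sdiff
        (Finset.union_sdiff_of_subset (Finset.mem_powersetCard.1 hJk).1) hvC, hCJ]
      exact hcut J' hJC'.1 hJlt
    have hIJ : I ≠ J := by
      intro e
      have h1 : I.Nonempty := by rw [← Finset.card_pos]; omega
      have h2 : J'.Nonempty := by rw [← Finset.card_pos]; omega
      obtain ⟨p, hp⟩ := h1
      obtain ⟨q, hq⟩ := h2
      refine lt_asymm (hIlt p hp q ?_) (hJlt q hq p (e ▸ hp))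
      rw [e, hCJ]; exact hq
    have hsep : F.filter (fun A => Separated A (C \ A)) = {I, J} := by
      ext A
      rw [Finset.mem_filter, Finset.mem_insert, Finset.mem_singleton]
      constructor
      · rintro ⟨hA, hs | hs⟩
        · exact Or.inl (initial_unique (Finset.mem_filter.1 hA).1 hI hs hIlt)
        · right
          have hAC := Finset.mem_powersetCard.1 (Finset.mem_filter.1 hA).1
          have : C \ A = J' := by
            refine initial_unique (k := C.card - k) ?_ hJ' ?_ hJlt
            · refine Finset.mem_powersetCard.2 ⟨Finset.sdiff_subset, ?_⟩
              rw [Finset.card_sdiff_of_subset hAC.1, hAC.2]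
            · rw [Finset.sdiff_sdiff_eq_self hAC.1]
              exact fun i hi j hj => hs j hj i hi
          rw [hJ, ← this, Finset.sdiff_sdiff_eq_self hAC.1]
      · rintro (rfl | rfl)
        · exact ⟨hIF, Or.inl hIlt⟩
        · refine ⟨hJF, Or.inr fun i hi j hj => ?_⟩
          rw [hCJ] at hj
          exact hJlt j hj i hi
    have h1 : ∑ A ∈ C.powersetCard k, arcWeight v C A =
        ∑ A ∈ F, X ^ (if Separated A (C \ A) then 0 else 1) := by
      rw [hF, Finset.sum_filter]
      refine Finset.sum_congr rfl fun A _ => ?_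
      simp only [arcWeight, h2, IsEmpty.forall_iff, true_and]
    have h3 : ∀ A ∈ F, (X : ℤ[X]) ^ (if Separated A (C \ A) then 0 else 1) =
        if Separated A (C \ A) then 1 else X := by
      intro A _
      split_ifs <;> simp
    have h4 := Finset.card_filter_add_card_filter_not (s := F) (fun A => Separated A (C \ A))
    rw [hsep, Finset.card_pair hIJ, hFcard] at h4
    rw [h1, Finset.sum_congr rfl h3, Finset.sum_ite, hsep, Finset.sum_const, Finset.sum_const,
      Finset.card_pair hIJ, ← h4]
    simp
    ring

end Counting

end TypeA

/-! ### Summation over the symmetric group -/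

namespace TypeA

open Equiv Equiv.Perm Polynomial

variable {m : ℕ}

open Classical in
/-- The permutations preserving each class of `r`. -/
noncomputable def stab (r : Setoid (Fin (m + 1))) : Finset (W m) :=
  Finset.univ.filter fun g => ∀ i, r i (g i)

section Stab

variable {r s : Setoid (Fin (m + 1))}

@[simp] lemma mem_stab {g : W m} : g ∈ stab r ↔ ∀ i, r i (g i) := by simp [stab]

lemma mul_mem_stab {g h : W m} (hg : g ∈ stab r) (hh : h ∈ stab r) : g * h ∈ stab r := by
  rw [mem_stab] at *
  exact fun i => r.trans (hh i) (hg (h i))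

lemma inv_mem_stab {g : W m} (hg : g ∈ stab r) : g⁻¹ ∈ stab r := by
  rw [mem_stab] at *
  intro i
  have := hg (g⁻¹ i)
  rw [apply_inv_apply] at this
  exact r.symm this

lemma stab_mono (h : r ≤ s) : stab r ⊆ stab s := by
  intro g hg
  rw [mem_stab] at *
  exact fun i => h (hg i)

lemma card_stab_ne_zero (r : Setoid (Fin (m + 1))) : ((stab r).card : ℤ[X]) ≠ 0 := by
  rw [Nat.cast_ne_zero, Finset.card_ne_zero]
  exact ⟨1, mem_stab.2 r.refl⟩

lemma comap_inv_eq_of_mem_stab (w : W m) {g : W m} (hg : g ∈ stab r) :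
    r.comap ⇑(w * g)⁻¹ = r.comap ⇑w⁻¹ := by
  have hg' := mem_stab.1 (inv_mem_stab hg)
  ext i j
  rw [Setoid.comap_rel, Setoid.comap_rel, mul_inv_rev, Perm.mul_apply, Perm.mul_apply]
  exact ⟨fun h => r.trans (hg' _) (r.trans h (r.symm (hg' _))),
    fun h => r.trans (r.symm (hg' _)) (r.trans h (hg' _))⟩

end Stab

lemma IsMergeChain.monotone {R : Fin (m + 1) → Setoid (Fin (m + 1))} {x y : Fin m → Fin (m + 1)}
    (h : IsMergeChain R x y) : Monotone R :=
  Fin.monotone_iff_le_succ.2 fun j => (h.step j).le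

/-- Summation over the symmetric group of a product of weights, one for each merging. -/
lemma sum_prod_eq_prod {R : Fin (m + 1) → Setoid (Fin (m + 1))} {x y : Fin m → Fin (m + 1)}
    (hR : IsMergeChain R x y) (f : Fin m → W m → ℤ[X]) (F : Fin m → ℤ[X])
    (good : Fin (m + 1) → W m → Prop) (hlast : ∀ w, good (Fin.last m) w)
    (hgood : ∀ j w, f j w ≠ 0 → good j.castSucc w)
    (hinv : ∀ j w, ∀ g ∈ stab (R j.castSucc), f j (w * g) = f j w)
    (hsum : ∀ j w, good j.succ w →
      ∑ g ∈ stab (R j.succ), f j (w * g) = (stab (R j.castSucc)).card * F j) :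
    ∑ w, ∏ j, f j w = ∏ j, F j := by
  -- Only the mergings from `i` on are taken into account. Their weights are invariant under `stab
  -- (R i)`, which accounts for the factor; for `i = 0` this group is trivial.
  have main : ∀ i : Fin (m + 1), ∑ w, ∏ k with i ≤ Fin.castSucc k, f k w =
      (stab (R i)).card * ∏ k with i ≤ Fin.castSucc k, F k := by
    intro i
    induction i using Fin.reverseInduction with
    | last =>
      have h1 : (Finset.univ.filter fun k : Fin m => Fin.last m ≤ k.castSucc) = ∅ := by
        refine Finset.filter_false_of_mem fun k _ => ?_
        exact not_le.2 (Fin.castSucc_lt_last k)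
      have h2 : stab (R (Fin.last m)) = Finset.univ := by
        refine Finset.eq_univ_of_forall fun g => mem_stab.2 fun i => ?_
        rw [hR.last]
        trivial
      rw [h1, h2]
      simp
    | cast j ih =>
      have h1 : (Finset.univ.filter fun k : Fin m => j.castSucc ≤ k.castSucc) =
          insert j (Finset.univ.filter fun k : Fin m => j.succ ≤ k.castSucc) := by
        ext k
        simp only [Finset.mem_filter, Finset.mem_univ, true_and, Finset.mem_insert, Fin.le_def,
          Fin.val_castSucc, Fin.val_succ, Fin.ext_iff]
        omega
      have h2 : j ∉ Finset.univ.filter fun k : Fin m => j.succ ≤ k.castSucc := by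
        simp [Fin.le_def]
      set f' : W m → ℤ[X] := fun w => ∏ k with j.succ ≤ Fin.castSucc k, f k w with hf'
      have h3 : ∀ w, ∀ g ∈ stab (R j.succ), f' (w * g) = f' w := by
        intro w g hg
        refine Finset.prod_congr rfl fun k hk => hinv k w g ?_
        exact stab_mono (hR.monotone (Finset.mem_filter.1 hk).2) hg
      -- The next merging is one of the factors of `f' w`; when there is none, `j.succ` is last and
      -- `hlast` applies.
      have h4 : ∀ w, f' w ≠ 0 → good j.succ w := by
        intro w hw
        by_cases hj : j.succ = Fin.last m
        · rw [hj]; exact hlast w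
        · obtain ⟨k, hk⟩ := Fin.exists_castSucc_eq.2 hj
          rw [← hk]
          refine hgood k w (Finset.prod_ne_zero_iff.1 hw k ?_)
          rw [Finset.mem_filter]
          exact ⟨Finset.mem_univ _, hk.ge⟩
      -- Averaging over right translation by `stab (R j.succ)`, under which the later weights `f'`
      -- are invariant.
      have h5 : ((stab (R j.succ)).card : ℤ[X]) * ∑ w, f j w * f' w =
          (stab (R j.castSucc)).card * F j * ∑ w, f' w := by
        calc ((stab (R j.succ)).card : ℤ[X]) * ∑ w, f j w * f' w
            = ∑ g ∈ stab (R j.succ), ∑ w, f j (w * g) * f' (w * g) := by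
              rw [← nsmul_eq_mul, ← Finset.sum_const]
              refine Finset.sum_congr rfl fun g _ => ?_
              exact (Equiv.sum_comp (Equiv.mulRight g) fun w => f j w * f' w).symm
          _ = ∑ w, (∑ g ∈ stab (R j.succ), f j (w * g)) * f' w := by
              rw [Finset.sum_comm]
              refine Finset.sum_congr rfl fun w _ => ?_
              rw [Finset.sum_mul]
              exact Finset.sum_congr rfl fun g hg => by rw [h3 w g hg]
          _ = _ := by
              rw [Finset.mul_sum]
              refine Finset.sum_congr rfl fun w _ => ?_
              by_cases hw : f' w = 0
              · rw [hw, mul_zero, mul_zero]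
              · rw [hsum j w (h4 w hw)]
      simp only [h1, Finset.prod_insert h2]
      apply mul_left_cancel₀ (card_stab_ne_zero (R j.succ))
      rw [h5, ih]
      ring
  have h0 := main 0
  have h1 : (Finset.univ.filter fun k : Fin m => 0 ≤ k.castSucc) = Finset.univ :=
    Finset.filter_true_of_mem fun k _ => Fin.zero_le _
  have h2 : stab (R 0) = {1} := by
    ext g
    rw [mem_stab, hR.zero, Finset.mem_singleton]
    exact ⟨fun h => Equiv.ext fun i => (h i).symm, fun h i => by rw [h]; exact rfl⟩
  rw [h1, h2] at h0
  simpa using h0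

/-! ### The total weight of the splittings of one block -/

section Local

variable {R R' : Setoid (Fin (m + 1))} {a b : Fin (m + 1)}

lemma Merges.symm (h : Merges R R' a b) : Merges R R' b a :=
  ⟨fun e => h.1 (R.symm e), fun i j => by rw [h.2, or_comm (a := R a i), or_comm (a := R a j)]⟩

/-- A permutation of `C` carrying `A` to `A'`. -/
lemma exists_perm_map_eq {α : Type*} [Fintype α] [DecidableEq α] {C A A' : Finset α} (hA : A ⊆ C)
    (hA' : A' ⊆ C) (hcard : A.card = A'.card) :
    ∃ g : Perm α, (∀ i ∉ C, g i = i) ∧ (∀ i ∈ C, g i ∈ C) ∧ A.map g.toEmbedding = A' := by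
  have hc : Fintype.card {z : {z // z ∈ C} // z.1 ∈ A} =
      Fintype.card {z : {z // z ∈ C} // z.1 ∈ A'} := by
    rw [Fintype.card_congr (Equiv.subtypeSubtypeEquivSubtype fun {z} hz => hA hz),
      Fintype.card_congr (Equiv.subtypeSubtypeEquivSubtype fun {z} hz => hA' hz),
      Fintype.card_coe, Fintype.card_coe, hcard]
  let e := Fintype.equivOfCardEq hc
  let h : Perm {z // z ∈ C} := e.extendSubtype
  refine ⟨ofSubtype h, fun i hi => ofSubtype_apply_of_not_mem h hi, fun i hi => ?_, ?_⟩
  · rw [ofSubtype_apply_of_mem h hi]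
    exact (h ⟨i, hi⟩).2
  · refine Finset.eq_of_subset_of_card_le (fun i hi => ?_) (by rw [Finset.card_map, hcard])
    obtain ⟨j, hj, rfl⟩ := Finset.mem_map.1 hi
    change ofSubtype h j ∈ A'
    rw [ofSubtype_apply_of_mem h (hA hj)]
    exact e.extendSubtype_mem ⟨j, hA hj⟩ hj

/-- These permutations form the coset `g₀ * stab R`, for any `g₀` in `stab R'` carrying the class of
`a` to `A`. -/
lemma Merges.card_stab_map_eq (h : Merges R R' a b) {A : Finset (Fin (m + 1))}
    (hA : A ∈ (cls R' a).powersetCard (cls R a).card) :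
    ((stab R').filter fun g => (cls R a).map g.toEmbedding = A).card = (stab R).card := by
  rw [Finset.mem_powersetCard] at hA
  obtain ⟨g₀, h1, h2, h3⟩ := exists_perm_map_eq (C := cls R' a) (A := cls R a)
    (h.cls_union ▸ Finset.subset_union_left) hA.1 hA.2.symm
  have hg₀ : g₀ ∈ stab R' := by
    rw [mem_stab]
    intro i
    by_cases hi : i ∈ cls R' a
    · exact R'.trans (R'.symm (mem_cls.1 hi)) (mem_cls.1 (h2 i hi))
    · rw [h1 i hi]
  have hmem : ∀ (g : W m) i, (cls R a).map g.toEmbedding = A → (g i ∈ A ↔ R a i) := by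
    rintro g i rfl
    rw [Finset.mem_map_equiv, mem_cls, symm_apply_apply]
  symm
  refine Finset.card_bij (fun g _ => g₀ * g) ?_ ?_ ?_
  · intro g hg
    refine Finset.mem_filter.2 ⟨mul_mem_stab hg₀ (stab_mono h.le hg), ?_⟩
    rw [← h3]
    ext i
    rw [mem_stab] at hg
    rw [Finset.mem_map_equiv, Finset.mem_map_equiv, mem_cls, mem_cls]
    change R a ((g₀ * g)⁻¹ i) ↔ R a (g₀⁻¹ i)
    have := hg ((g₀ * g)⁻¹ i)
    rw [mul_inv_rev, Perm.mul_apply, apply_inv_apply] at this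
    rw [mul_inv_rev, Perm.mul_apply]
    exact ⟨fun e => R.trans e this, fun e => R.trans e (R.symm this)⟩
  · intro g _ g' _ e
    exact mul_left_cancel e
  · intro g hg
    rw [Finset.mem_filter] at hg
    refine ⟨g₀⁻¹ * g, mem_stab.2 fun i => ?_, mul_inv_cancel_left _ _⟩
    have e1 : R a i ↔ R a ((g₀⁻¹ * g) i) := by
      rw [← hmem g i hg.2, ← hmem g₀ _ h3, Perm.mul_apply, apply_inv_apply]
    have e2 := (h.2 _ _).1 (mem_stab.1 (mul_mem_stab (inv_mem_stab hg₀) hg.1) i)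
    rcases e2 with e2 | ⟨e2, e3⟩
    · exact e2
    · by_cases ha : R a i
      · exact R.trans (R.symm ha) (e1.1 ha)
      · have ha' := mt e1.2 ha
        exact R.trans (R.symm (e2.resolve_left ha)) (e3.resolve_left ha')

lemma Merges.sum_stab (h : Merges R R' a b) (φ : Finset (Fin (m + 1)) → ℤ[X]) :
    ∑ g ∈ stab R', φ ((cls R a).map g.toEmbedding) =
      (stab R).card * ∑ A ∈ (cls R' a).powersetCard (cls R a).card, φ A := by
  have hmaps : ∀ g ∈ stab R', (cls R a).map g.toEmbedding ∈
      (cls R' a).powersetCard (cls R a).card := by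
    intro g hg
    rw [mem_stab] at hg
    refine Finset.mem_powersetCard.2 ⟨fun i hi => ?_, Finset.card_map _⟩
    obtain ⟨j, hj, rfl⟩ := Finset.mem_map.1 hi
    exact mem_cls.2 (R'.trans (h.le (mem_cls.1 hj)) (hg j))
  rw [← Finset.sum_fiberwise_of_maps_to hmaps, Finset.mul_sum]
  refine Finset.sum_congr rfl fun A hA => ?_
  rw [← h.card_stab_map_eq hA, ← nsmul_eq_mul, ← Finset.sum_const]
  exact Finset.sum_congr rfl fun g hg => by rw [(Finset.mem_filter.1 hg).2]

lemma weight_congr {p p' q q' : Prop} {_ : Decidable p} {_ : Decidable p'} {_ : Decidable q}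
    {_ : Decidable q'}
    (hp : p ↔ p') (hq : q ↔ q') :
    (if p then (X : ℤ[X]) ^ (if q then 0 else 1) else 0) =
      if p' then X ^ (if q' then 0 else 1) else 0 := by
  simp only [hp, hq]

open Classical in
/-- The weight contributed to `w` by the merging of the classes of `a` and `b`. -/
noncomputable def mergeWeight (c : W m) (R R' : Setoid (Fin (m + 1))) (a b : Fin (m + 1))
    (w : W m) : ℤ[X] :=
  if ((cls R' a).card = 2 → w a < w b) ∧ subOf (R.comap ⇑w⁻¹) ∈ noncrossing c then
    X ^ (if IntervalRefinement (subOf (R.comap ⇑w⁻¹)) (subOf (R'.comap ⇑w⁻¹)) then 0 else 1)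
  else 0

lemma Merges.cls_eq_singleton (h : Merges R R' a b) (hC : (cls R' a).card = 2) :
    cls R a = {a} ∧ cls R b = {b} := by
  have h1 : 0 < (cls R a).card := Finset.card_pos.2 ⟨a, self_mem_cls⟩
  have h2 : 0 < (cls R b).card := Finset.card_pos.2 ⟨b, self_mem_cls⟩
  rw [← h.cls_union, Finset.card_union_of_disjoint h.disjoint_cls] at hC
  constructor
  · obtain ⟨z, hz⟩ := Finset.card_eq_one.1 (show (cls R a).card = 1 by omega)
    have := self_mem_cls (R := R) (a := a)
    rw [hz, Finset.mem_singleton] at this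
    rw [hz, this]
  · obtain ⟨z, hz⟩ := Finset.card_eq_one.1 (show (cls R b).card = 1 by omega)
    have := self_mem_cls (R := R) (a := b)
    rw [hz, Finset.mem_singleton] at this
    rw [hz, this]

/-- The partitions do not change, and in a block of size two `a` and `b` are singleton classes of
`R`, hence fixed by `g`. -/
lemma Merges.mergeWeight_mul {c : W m} (h : Merges R R' a b) (w : W m) {g : W m}
    (hg : g ∈ stab R) : mergeWeight c R R' a b (w * g) = mergeWeight c R R' a b w := by
  have h1 : ((cls R' a).card = 2 → (w * g) a < (w * g) b) ↔ ((cls R' a).card = 2 → w a < w b) := by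
    refine imp_congr_right fun hC => ?_
    obtain ⟨e1, e2⟩ := h.cls_eq_singleton hC
    have e3 := mem_cls.2 (mem_stab.1 hg a)
    have e4 := mem_cls.2 (mem_stab.1 hg b)
    rw [e1, Finset.mem_singleton] at e3
    rw [e2, Finset.mem_singleton] at e4
    rw [Perm.mul_apply, Perm.mul_apply, e3, e4]
  unfold mergeWeight
  rw [comap_inv_eq_of_mem_stab w hg, comap_inv_eq_of_mem_stab w (stab_mono h.le hg)]
  exact weight_congr (and_congr_left fun _ => h1) Iff.rfl

lemma map_mul_toEmbedding (w g : W m) (A : Finset (Fin (m + 1))) :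
    A.map (w * g).toEmbedding = (A.map g.toEmbedding).map w.toEmbedding := by
  rw [Finset.map_map]; rfl

lemma Merges.mergeWeight_eq_arcWeight {c v w g : W m} (hc : dimFix c = 0) (h : Merges R R' a b)
    (hv : Under c v) (hR' : subOf (R'.comap ⇑w⁻¹) = fix v) (hg : g ∈ stab R') :
    mergeWeight c R R' a b (w * g) = arcWeight v ((cls R' a).map w.toEmbedding)
      (((cls R a).map g.toEmbedding).map w.toEmbedding) := by
  have hM := h.comap (w * g)
  have hcomap := comap_inv_eq_of_mem_stab w hg
  have hR'' : subOf (R'.comap ⇑(w * g)⁻¹) = fix v := by rw [hcomap, hR']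
  have hC : cls (R'.comap ⇑(w * g)⁻¹) ((w * g) a) = (cls R' a).map w.toEmbedding := by
    rw [cls_comap, map_mul_toEmbedding]
    congr 1
    refine Finset.eq_of_subset_of_card_le (fun i hi => ?_) (by rw [Finset.card_map])
    obtain ⟨j, hj, rfl⟩ := Finset.mem_map.1 hi
    exact mem_cls.2 (R'.trans (mem_cls.1 hj) (mem_stab.1 hg j))
  have hA : cls (R.comap ⇑(w * g)⁻¹) ((w * g) a) =
      ((cls R a).map g.toEmbedding).map w.toEmbedding := by
    rw [cls_comap, map_mul_toEmbedding]
  have hB := hM.sdiff_cls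
  rw [hC, hA] at hB
  have hnorm : ((cls R' a).card = 2 → (w * g) a < (w * g) b) ↔ ((cls R' a).card = 2 →
      ∀ i ∈ ((cls R a).map g.toEmbedding).map w.toEmbedding,
        ∀ j ∈ cls (R.comap ⇑(w * g)⁻¹) ((w * g) b), i < j) := by
    refine imp_congr_right fun h2 => ?_
    have h3 := hM.cls_eq_singleton (by rw [hC, Finset.card_map, h2])
    rw [← hA, h3.1, h3.2]
    simp
  unfold mergeWeight arcWeight
  rw [hB, Finset.card_map]
  refine weight_congr (and_congr hnorm ?_) ?_
  · rw [hM.mem_noncrossing_iff hc hv hR'', hA]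
  · rw [hM.intervalRefinement_iff, hA]

/-- The sum of the weights over the ways of splitting a block. -/
lemma Merges.sum_mergeWeight {c w : W m} (hc : dimFix c = 0) (hcut : CutProperty c)
    (h : Merges R R' a b) (hw : subOf (R'.comap ⇑w⁻¹) ∈ noncrossing c) :
    ∑ g ∈ stab R', mergeWeight c R R' a b (w * g) = (stab R).card *
      (if (cls R' a).card = 2 then 1 else 2 + X * Polynomial.C (((cls R' a).card : ℤ) - 2)) := by
  obtain ⟨v, hv, hR'⟩ := (TypeA.mem_noncrossing_iff hc).1 hw
  rw [Finset.sum_congr rfl fun g hg => h.mergeWeight_eq_arcWeight hc hv hR' hg,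
    h.sum_stab fun A => arcWeight v ((cls R' a).map w.toEmbedding) (A.map w.toEmbedding)]
  congr 1
  set C := (cls R' a).map w.toEmbedding with hC
  have hs : ∀ i j, R'.comap ⇑w⁻¹ i j ↔ SameCycle v i j := by
    intro i j
    rw [← relOf_fix, ← hR', relOf_subOf]
  have hCs : ∀ i, i ∈ C ↔ SameCycle v (w a) i := by
    intro i
    rw [hC, ← cls_comap, mem_cls, hs]
  have hcyc : v.IsCycleOn C := by
    refine ⟨v.bijOn fun i => ?_, fun i hi j hj => ?_⟩
    · rw [Finset.mem_coe, Finset.mem_coe, hCs, hCs, sameCycle_apply_right]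
    · rw [Finset.mem_coe, hCs] at hi hj
      exact hi.symm.trans hj
  -- With `t` the largest element of `A`, an exit from the initial segment `A` is a step of `v`
  -- across the cut after `t`.
  have hinit : ∀ A ⊆ C, (∀ i ∈ A, ∀ j ∈ C \ A, i < j) → (exits v A (C \ A)).card ≤ 1 := by
    intro A hAC hlt
    refine Finset.card_le_one.2 fun p hp q hq => ?_
    simp only [exits, Finset.mem_filter] at hp hq
    obtain ⟨t, ht, ht'⟩ := Finset.exists_max_image A id ⟨p, hp.1⟩
    refine exit_unique_of_cutProperty hc hcut hv (t := t) ?_ (ht' p hp.1) (ht' q hq.1)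
      (hlt t ht _ hp.2) (hlt t ht _ hq.2)
    exact ((hCs p).1 (hAC hp.1)).symm.trans ((hCs q).1 (hAC hq.1))
  have h1 : 1 ≤ (cls R a).card := Finset.card_pos.2 ⟨a, self_mem_cls⟩
  have h2 : (cls R a).card < C.card := by
    have h3 : 0 < (cls R b).card := Finset.card_pos.2 ⟨b, self_mem_cls⟩
    rw [hC, Finset.card_map, ← h.cls_union, Finset.card_union_of_disjoint h.disjoint_cls]
    omega
  have key := sum_arcWeight hcyc hinit h1 h2
  rw [hC, Finset.powersetCard_map, Finset.sum_map, ← hC, hC, Finset.card_map, ← hC] at key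
  exact key

end Local

end TypeA

/-! ### One normalized permutation for each chain of the class -/

namespace TypeA

open Equiv Equiv.Perm Polynomial

variable {m : ℕ} {R : Fin (m + 1) → Setoid (Fin (m + 1))} {x y : Fin m → Fin (m + 1)}

/-- The block created by the `j`-th merging. -/
noncomputable def newBlock (R : Fin (m + 1) → Setoid (Fin (m + 1))) (x : Fin m → Fin (m + 1))
    (j : Fin m) : Finset (Fin (m + 1)) :=
  cls (R j.succ) (x j)

/-- `w` is increasing on the new blocks with two elements. -/
def Normalized (R : Fin (m + 1) → Setoid (Fin (m + 1))) (x y : Fin m → Fin (m + 1)) (w : W m) :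
    Prop :=
  ∀ j, (newBlock R x j).card = 2 → w (x j) < w (y j)

lemma actChain_eq (w : W m) :
    actChain w (fun i => subOf (R i)) = fun i => subOf ((R i).comap ⇑w⁻¹) :=
  funext fun _ => map_act_subOf w _

lemma comap_swap {r : Setoid (Fin (m + 1))} {a b : Fin (m + 1)}
    (h : r a b ∨ (cls r a = {a} ∧ cls r b = {b})) : r.comap (swap a b) = r := by
  have key : ∀ i j, r i j → r (swap a b i) (swap a b j) := by
    intro i j hij
    rcases h with h | ⟨h1, h2⟩
    · have : ∀ i, r (swap a b i) i := by
        intro i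
        rw [swap_apply_def]
        split_ifs with e1 e2
        · rw [e1]; exact r.symm h
        · rw [e2]; exact h
        · exact r.refl i
      exact r.trans (this i) (r.trans hij (r.symm (this j)))
    · have h1' : ∀ i, r a i → i = a := fun i hi => by
        have := mem_cls.2 hi
        rwa [h1, Finset.mem_singleton] at this
      have h2' : ∀ i, r b i → i = b := fun i hi => by
        have := mem_cls.2 hi
        rwa [h2, Finset.mem_singleton] at this
      have : i = j ∨ ((i ≠ a ∧ i ≠ b) ∧ (j ≠ a ∧ j ≠ b)) := by
        by_cases e1 : i = a
        · subst e1; exact Or.inl (h1' j hij).symm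
        by_cases e2 : i = b
        · subst e2; exact Or.inl (h2' j hij).symm
        by_cases e3 : j = a
        · subst e3; exact Or.inl (h1' i (r.symm hij))
        by_cases e4 : j = b
        · subst e4; exact Or.inl (h2' i (r.symm hij))
        exact Or.inr ⟨⟨e1, e2⟩, e3, e4⟩
      rcases this with rfl | ⟨⟨e1, e2⟩, e3, e4⟩
      · exact r.refl _
      · rwa [swap_apply_of_ne_of_ne e1 e2, swap_apply_of_ne_of_ne e3 e4]
  ext i j
  rw [Setoid.comap_rel]
  refine ⟨fun hij => ?_, key i j⟩
  have := key _ _ hij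
  rwa [swap_apply_self, swap_apply_self] at this

/-- Before the `j`-th merging both points are singletons, afterwards they are equivalent; in either
case exchanging them changes no partition of the chain. -/
lemma IsMergeChain.comap_swap (h : IsMergeChain R x y) {j : Fin m}
    (hj : (newBlock R x j).card = 2) (i : Fin (m + 1)) : (R i).comap (swap (x j) (y j)) = R i := by
  apply TypeA.comap_swap
  by_cases hij : j.succ ≤ i
  · exact Or.inl (h.monotone hij (h.step j).rel)
  · right
    have hij' : i ≤ j.castSucc := by
      rw [Fin.le_def] at *
      simp only [Fin.val_succ, Fin.val_castSucc] at *
      omega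
    obtain ⟨e1, e2⟩ := (h.step j).cls_eq_singleton hj
    have key : ∀ a, cls (R j.castSucc) a = {a} → cls (R i) a = {a} := by
      intro a ha
      ext k
      rw [Finset.mem_singleton]
      refine ⟨fun hk => ?_, fun hk => hk ▸ self_mem_cls⟩
      rw [← Finset.mem_singleton, ← ha, mem_cls]
      exact h.monotone hij' (mem_cls.1 hk)
    exact ⟨key _ e1, key _ e2⟩

/-- The later block consists of two points that were singletons until then, whereas the points of
the earlier block no longer are. -/
lemma IsMergeChain.disjoint_newBlock (h : IsMergeChain R x y) {j k : Fin m} (hjk : j < k)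
    (hj : (newBlock R x j).card = 2) (hk : (newBlock R x k).card = 2) :
    Disjoint (newBlock R x j) (newBlock R x k) := by
  rw [Finset.disjoint_left]
  intro p hp hp'
  have hle : R j.succ ≤ R k.castSucc := h.monotone (by
    rw [Fin.le_def]; simpa using hjk)
  obtain ⟨e1, e2⟩ := (h.step k).cls_eq_singleton hk
  rw [newBlock, mem_cls] at hp
  rw [newBlock, mem_cls, (h.step k).rel_left_iff] at hp'
  have h1 : ∀ q, R j.succ (x j) q → R k.castSucc p q := fun q hq =>
    hle ((R j.succ).trans ((R j.succ).symm hp) hq)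
  have h2 : ∀ q, R k.castSucc p q → q = p := by
    intro q hq
    rcases hp' with e | e
    · have a1 := mem_cls.2 e
      have a2 := mem_cls.2 ((R k.castSucc).trans e hq)
      rw [e1, Finset.mem_singleton] at a1 a2
      rw [a1, a2]
    · have a1 := mem_cls.2 e
      have a2 := mem_cls.2 ((R k.castSucc).trans e hq)
      rw [e2, Finset.mem_singleton] at a1 a2
      rw [a1, a2]
  have h3 : newBlock R x j ⊆ {p} := fun q hq => by
    rw [newBlock, mem_cls] at hq
    exact Finset.mem_singleton.2 (h2 q (h1 q hq))
  have := Finset.card_le_card h3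
  rw [hj, Finset.card_singleton] at this
  omega

lemma mem_newBlock_left (j : Fin m) : x j ∈ newBlock R x j := self_mem_cls

lemma IsMergeChain.mem_newBlock_right (h : IsMergeChain R x y) (j : Fin m) :
    y j ∈ newBlock R x j := mem_cls.2 (h.step j).rel

lemma IsMergeChain.exists_normalized (h : IsMergeChain R x y) (w : W m) :
    ∃ w' : W m, (∀ i, (R i).comap ⇑w'⁻¹ = (R i).comap ⇑w⁻¹) ∧ Normalized R x y w' := by
  have main : ∀ S : Finset (Fin m), ∃ w' : W m, (∀ i, (R i).comap ⇑w'⁻¹ = (R i).comap ⇑w⁻¹) ∧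
      ∀ j ∈ S, (newBlock R x j).card = 2 → w' (x j) < w' (y j) := by
    intro S
    induction S using Finset.induction_on with
    | empty => exact ⟨w, fun _ => rfl, by simp⟩
    | insert j S hjS ih =>
      obtain ⟨w', h1, h2⟩ := ih
      by_cases hj : (newBlock R x j).card = 2 → w' (x j) < w' (y j)
      · refine ⟨w', h1, fun k hk => ?_⟩
        rcases Finset.mem_insert.1 hk with rfl | hk
        exacts [hj, h2 k hk]
      · push Not at hj
        obtain ⟨hj2, hle⟩ := hj
        refine ⟨w' * swap (x j) (y j), fun i => ?_, fun k hk hk2 => ?_⟩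
        · rw [← h1 i]
          ext p q
          conv_rhs => rw [Setoid.comap_rel, ← h.comap_swap hj2 i]
          rw [Setoid.comap_rel, Setoid.comap_rel, mul_inv_rev, swap_inv]
          rfl
        · rw [Perm.mul_apply, Perm.mul_apply]
          by_cases hkj : k = j
          · subst hkj
            rw [swap_apply_left, swap_apply_right]
            refine lt_of_le_of_ne hle fun e => (h.step k).1 ?_
            rw [w'.injective e]
          · have hd : Disjoint (newBlock R x k) (newBlock R x j) := by
              rcases lt_or_gt_of_ne hkj with e | e
              · exact h.disjoint_newBlock e hk2 hj2
              · exact (h.disjoint_newBlock e hj2 hk2).symm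
            have hne : ∀ p ∈ newBlock R x k, swap (x j) (y j) p = p := by
              intro p hp
              have hp' := Finset.disjoint_left.1 hd hp
              refine swap_apply_of_ne_of_ne ?_ ?_
              · rintro rfl; exact hp' (mem_newBlock_left j)
              · rintro rfl; exact hp' (h.mem_newBlock_right j)
            rw [hne _ (mem_newBlock_left k), hne _ (h.mem_newBlock_right k)]
            rcases Finset.mem_insert.1 hk with rfl | hk
            · exact absurd rfl hkj
            · exact h2 k hk hk2
  obtain ⟨w', h1, h2⟩ := main Finset.univ
  exact ⟨w', h1, fun j => h2 j (Finset.mem_univ j)⟩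

/-- A symmetry of both partitions preserves the only block that is new. It therefore fixes a
singleton part of that block, unless the other part is a singleton too and the two are exchanged. -/
lemma Merges.apply_eq_of_cls_singleton {r r' : Setoid (Fin (m + 1))} {a b : Fin (m + 1)}
    (h : Merges r r' a b) {u : W m} (hu : ∀ p q, r (u p) (u q) ↔ r p q)
    (hu' : ∀ p q, r' (u p) (u q) ↔ r' p q) (ha : cls r a = {a}) :
    u a = a ∨ (u a = b ∧ u b = a ∧ (cls r' a).card = 2) := by
  have ha' : ∀ q, r a q → q = a := fun q hq => by
    have := mem_cls.2 hq
    rwa [ha, Finset.mem_singleton] at this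
  have hua : ∀ q, r (u a) q → q = u a := by
    intro q hq
    rw [← apply_inv_apply u q, hu] at hq
    rw [← ha' _ hq, apply_inv_apply]
  have hr' := (hu' a b).2 h.rel
  have hnr := mt (hu a b).1 h.1
  obtain ⟨h1, h2⟩ := ((h.2 _ _).1 hr').resolve_left hnr
  rcases h1 with h1 | h1
  · exact Or.inl (ha' _ h1)
  · have e1 := hua _ (r.symm h1)
    right
    have hb : ∀ q, r b q → q = b := by
      intro q hq
      rw [e1]
      exact hua q (by rwa [← e1])
    have e2 : u b = a := by
      rcases h2 with h2 | h2
      · exact ha' _ h2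
      · exact absurd (r.trans (r.symm h1) h2) hnr
    refine ⟨e1.symm, e2, ?_⟩
    have hb' : cls r b = {b} := by
      ext q
      rw [mem_cls, Finset.mem_singleton]
      exact ⟨hb q, fun e => by rw [e]⟩
    rw [← h.cls_union, Finset.card_union_of_disjoint h.disjoint_cls, ha, hb']
    simp

lemma IsMergeChain.eq_of_normalized (h : IsMergeChain R x y) {w w' : W m}
    (hw : Normalized R x y w) (hw' : Normalized R x y w')
    (heq : ∀ i, (R i).comap ⇑w⁻¹ = (R i).comap ⇑w'⁻¹) : w = w' := by
  set u : W m := w'⁻¹ * w with hu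
  have hR : ∀ i p q, R i (u p) (u q) ↔ R i p q := by
    intro i p q
    have h1 : (R i).comap ⇑w⁻¹ (w p) (w q) ↔ (R i).comap ⇑w'⁻¹ (w p) (w q) := by rw [heq i]
    rw [Setoid.comap_rel, Setoid.comap_rel, inv_apply_apply, inv_apply_apply] at h1
    exact h1.symm
  have hwu : ∀ p, w p = w' (u p) := by
    intro p
    rw [hu, Perm.mul_apply, apply_inv_apply]
  have hfix : ∀ p, u p = p := by
    intro p
    by_contra hne
    -- A point moved by `u` can never be merged: at its first merging `u` would fix it or reverse a
    -- block of size two, and the latter contradicts that `w` and `w'` both increase on it. But at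
    -- the end of the chain all points are equivalent.
    have hall : ∀ i, cls (R i) p = {p} := by
      intro i
      induction i using Fin.induction with
      | zero =>
        ext q
        rw [mem_cls, h.zero, Finset.mem_singleton]
        exact ⟨fun e => Eq.symm e, fun e => e ▸ rfl⟩
      | succ j ih =>
        have hs := h.step j
        have hp' : ∀ q, R j.castSucc p q → q = p := fun q hq => by
          have := mem_cls.2 hq
          rwa [ih, Finset.mem_singleton] at this
        by_cases hpx : R j.succ (x j) p
        · exfalso
          rcases hs.rel_left_iff.1 hpx with e | e
          · have e' := hp' _ ((R _).symm e)
            rw [← e'] at ih hne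
            rcases hs.apply_eq_of_cls_singleton (hR _) (hR _) ih with e1 | ⟨e1, e2, e3⟩
            · exact hne e1
            · have a1 := hw j e3
              have a2 := hw' j e3
              rw [hwu, hwu, e1, e2] at a1
              exact lt_asymm a1 a2
          · have e' := hp' _ ((R _).symm e)
            rw [← e'] at ih hne
            rcases hs.symm.apply_eq_of_cls_singleton (hR _) (hR _) ih with e1 | ⟨e1, e2, e3⟩
            · exact hne e1
            · rw [← hs.symm.cls_union, Finset.union_comm, hs.cls_union] at e3
              have a1 := hw j e3
              have a2 := hw' j e3
              rw [hwu, hwu, e1, e2] at a1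
              exact lt_asymm a1 a2
        · rw [← ih]
          ext q
          rw [mem_cls, mem_cls, hs.rel_iff_of_not hpx]
    have hmem : u p ∈ cls (R (Fin.last m)) p := by
      rw [mem_cls, h.last]
      trivial
    rw [hall, Finset.mem_singleton] at hmem
    exact hne hmem
  ext p
  rw [hwu, hfix]

/-- The class generating function as a product over the mergings. -/
lemma IsMergeChain.classGenFun_eq {c : W m} (hc : dimFix c = 0) (hcut : CutProperty c)
    (h : IsMergeChain R x y) :
    classGenFun c (fun i => subOf (R i)) = ∏ j, if (newBlock R x j).card = 2 then 1 else
      2 + X * Polynomial.C (((newBlock R x j).card : ℤ) - 2) := by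
  classical
  set P : Fin (m + 1) → Sub m := fun i => subOf (R i) with hP
  have hnir : ∀ w : W m, (X : ℤ[X]) ^ nir (actChain w P) = ∏ j : Fin m,
      X ^ (if IntervalRefinement (subOf ((R j.castSucc).comap ⇑w⁻¹))
        (subOf ((R j.succ).comap ⇑w⁻¹)) then 0 else 1) := by
    intro w
    rw [Finset.prod_pow_eq_pow_sum, nir, Finset.card_filter, hP, actChain_eq]
    congr 1
    refine Finset.sum_congr rfl fun j _ => ?_
    split_ifs <;> rfl
  have hmem : ∀ w : W m, actChain w P ∈ ncChains c ↔
      ∀ j : Fin m, subOf ((R j.castSucc).comap ⇑w⁻¹) ∈ noncrossing c := by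
    intro w
    rw [hP, actChain_eq]
    exact (h.comap w).mem_ncChains_iff hc
  have hclass : chainClass c P = (Finset.univ.filter fun w : W m =>
      Normalized R x y w ∧ actChain w P ∈ ncChains c).image fun w => actChain w P := by
    ext Q
    simp only [chainClass, Finset.mem_filter, Finset.mem_image, Finset.mem_univ, true_and]
    constructor
    · rintro ⟨⟨w, rfl⟩, hQ⟩
      obtain ⟨w', h1, h2⟩ := h.exists_normalized w
      have e : actChain w' P = actChain w P := by
        rw [hP, actChain_eq, actChain_eq]
        exact funext fun i => congrArg subOf (h1 i)
      exact ⟨w', ⟨h2, e ▸ hQ⟩, e⟩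
    · rintro ⟨w, ⟨-, h2⟩, rfl⟩
      exact ⟨⟨w, rfl⟩, h2⟩
  have hinj : Set.InjOn (fun w => actChain w P) (Finset.univ.filter fun w : W m =>
      Normalized R x y w ∧ actChain w P ∈ ncChains c : Finset (W m)) := by
    intro w hw w' hw' e
    rw [Finset.mem_coe, Finset.mem_filter] at hw hw'
    refine h.eq_of_normalized hw.2.1 hw'.2.1 fun i => ?_
    simp only [hP, actChain_eq] at e
    exact subOf_injective (congrFun e i)
  rw [classGenFun, hclass, Finset.sum_image hinj, Finset.sum_filter]
  refine Eq.trans ?_ (sum_prod_eq_prod h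
    (fun j w => mergeWeight c (R j.castSucc) (R j.succ) (x j) (y j) w) _
    (fun i w => subOf ((R i).comap ⇑w⁻¹) ∈ noncrossing c)
    ?_ ?_ (fun j w g hg => (h.step j).mergeWeight_mul w hg)
    (fun j w hw => (h.step j).sum_mergeWeight hc hcut hw))
  · refine Finset.sum_congr rfl fun w _ => ?_
    unfold mergeWeight
    rw [Finset.prod_ite_zero, ← hnir]
    split_ifs with h1 h2 h2
    · rfl
    · exact absurd (fun j _ => ⟨h1.1 j, (hmem w).1 h1.2 j⟩) h2
    · exact absurd ⟨fun j => (h2 j (Finset.mem_univ j)).1,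
        (hmem w).2 fun j => (h2 j (Finset.mem_univ j)).2⟩ h1
    · rfl
  · intro w
    have : (R (Fin.last m)).comap ⇑w⁻¹ = ⊤ := (h.comap w).last
    rw [this, subOf_top]
    exact bot_mem_noncrossing hc
  · intro j w hne
    unfold mergeWeight at hne
    by_contra hn
    rw [if_neg fun e => hn e.2] at hne
    exact hne rfl

end TypeA

/-! ### Stanley's tree and its hooks -/

namespace TypeA

open Polynomial

variable {m : ℕ} {R : Fin (m + 1) → Setoid (Fin (m + 1))} {x y : Fin m → Fin (m + 1)}

lemma blocks_subOf (r : Setoid (Fin (m + 1))) :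
    blocks (subOf r) = Set.range fun i => (cls r i : Set (Fin (m + 1))) := by
  have key : ∀ i, {j | ∀ x ∈ subOf r, x j = x i} = (cls r i : Set (Fin (m + 1))) := by
    intro i
    ext j
    rw [Set.mem_ofPred_eq, ← relOf_iff, relOf_subOf, Finset.mem_coe, mem_cls]
    exact ⟨fun h => r.symm h, fun h => r.symm h⟩
  ext b
  simp only [blocks, key, Set.mem_ofPred_eq, Set.mem_range]
  exact ⟨fun ⟨i, e⟩ => ⟨i, e.symm⟩, fun ⟨i, e⟩ => ⟨i, e.symm⟩⟩

lemma cls_eq_of_rel {r : Setoid (Fin (m + 1))} {a b : Fin (m + 1)} (h : r a b) :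
    cls r a = cls r b := by
  ext i
  rw [mem_cls, mem_cls]
  exact ⟨fun e => r.trans (r.symm h) e, fun e => r.trans h e⟩

lemma Merges.cls_eq_of_not {r r' : Setoid (Fin (m + 1))} {a b i : Fin (m + 1)}
    (h : Merges r r' a b) (hi : ¬ r' a i) : cls r' i = cls r i := by
  ext j
  rw [mem_cls, mem_cls, h.rel_iff_of_not hi]

lemma Merges.blocks_sdiff {r r' : Setoid (Fin (m + 1))} {a b : Fin (m + 1)}
    (h : Merges r r' a b) :
    blocks (subOf r') \ blocks (subOf r) = {(cls r' a : Set (Fin (m + 1)))} := by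
  rw [blocks_subOf, blocks_subOf]
  ext s
  rw [Set.mem_sdiff, Set.mem_singleton_iff]
  constructor
  · rintro ⟨⟨i, rfl⟩, hi⟩
    by_cases hai : r' a i
    · simp only [cls_eq_of_rel hai]
    · exact absurd ⟨i, by simp only [h.cls_eq_of_not hai]⟩ hi
  · rintro rfl
    refine ⟨⟨a, rfl⟩, ?_⟩
    rintro ⟨i, hi⟩
    have hi' : cls r i = cls r' a := Finset.coe_injective hi
    have h1 : a ∈ cls r i := by rw [hi']; exact self_mem_cls
    have h2 : b ∈ cls r i := by rw [hi', mem_cls]; exact h.rel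
    exact h.1 (r.trans (r.symm (mem_cls.1 h1)) (mem_cls.1 h2))

lemma IsMergeChain.isStanleyImage_iff (h : IsMergeChain R x y) {T : AndreTree m} :
    IsStanleyImage (fun i => subOf (R i)) T ↔
      ∀ u v, T.Below u v ↔ newBlock R x u ⊆ newBlock R x v := by
  constructor
  · rintro ⟨b, h1, h2⟩ u v
    have hb : ∀ i, b i = (newBlock R x i : Set (Fin (m + 1))) := by
      intro i
      have := h1 i
      rw [(h.step i).blocks_sdiff] at this
      exact (Set.singleton_injective this).symm
    rw [h2, hb, hb, Finset.coe_subset]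
  · intro hT
    refine ⟨fun i => (newBlock R x i : Set (Fin (m + 1))), fun i => (h.step i).blocks_sdiff,
      fun u v => ?_⟩
    rw [hT, Finset.coe_subset]

/-- Classes only grow along the chain, so two blocks that meet are nested. -/
lemma IsMergeChain.newBlock_subset_of_mem (h : IsMergeChain R x y) {u v : Fin m} (huv : u ≤ v)
    {p : Fin (m + 1)} (hu : p ∈ newBlock R x u) (hv : p ∈ newBlock R x v) :
    newBlock R x u ⊆ newBlock R x v := by
  intro q hq
  rw [newBlock, mem_cls] at *
  have hle : R u.succ ≤ R v.succ := h.monotone (Fin.succ_le_succ_iff.2 huv)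
  exact (R _).trans hv (hle ((R _).trans ((R _).symm hu) hq))

lemma IsMergeChain.le_of_newBlock_subset (h : IsMergeChain R x y) {u v : Fin m}
    (hs : newBlock R x u ⊆ newBlock R x v) : u ≤ v := by
  by_contra hlt
  have h1 := hs (mem_newBlock_left u)
  have h2 := hs (h.mem_newBlock_right u)
  rw [newBlock, mem_cls] at h1 h2
  have hle : R v.succ ≤ R u.castSucc := h.monotone (by
    rw [Fin.le_def] at *; simp only [Fin.val_succ, Fin.val_castSucc]; omega)
  exact (h.step u).1 (hle ((R _).trans ((R _).symm h1) h2))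

lemma IsMergeChain.newBlock_injective (h : IsMergeChain R x y) :
    Function.Injective (newBlock R x) := fun _ _ e =>
  le_antisymm (h.le_of_newBlock_subset e.subset) (h.le_of_newBlock_subset e.symm.subset)

/-- A block stays a class as long as it is not involved in a merging. -/
lemma IsMergeChain.cls_eq_newBlock (h : IsMergeChain R x y) {u : Fin m} (i : Fin (m + 1))
    (hu : u.succ ≤ i)
    (hi : ∀ w : Fin m, u < w → w.castSucc < i → ¬ newBlock R x u ⊆ newBlock R x w) :
    cls (R i) (x u) = newBlock R x u := by
  induction i using Fin.induction with
  | zero => exact absurd hu (not_le.2 (Fin.succ_pos u))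
  | succ j ih =>
    rcases (Fin.succ_le_succ_iff.1 hu).eq_or_lt with rfl | hlt
    · rfl
    · have ih := ih (by rw [Fin.le_def]; simpa using hlt)
        fun w h1 h2 => hi w h1 (h2.trans (Fin.castSucc_lt_succ))
      rw [← ih]
      refine (h.step j).cls_eq_of_not fun hR => ?_
      exact hi j hlt Fin.castSucc_lt_succ
        (h.newBlock_subset_of_mem hlt.le (mem_newBlock_left u) (mem_cls.2 hR))

open Classical in
/-- The vertices strictly above `u`. -/
noncomputable def strictlyAbove (R : Fin (m + 1) → Setoid (Fin (m + 1))) (x : Fin m → Fin (m + 1))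
    (u : Fin m) : Finset (Fin m) :=
  Finset.univ.filter fun v => u < v ∧ newBlock R x u ⊆ newBlock R x v

lemma mem_strictlyAbove {u v : Fin m} :
    v ∈ strictlyAbove R x u ↔ u < v ∧ newBlock R x u ⊆ newBlock R x v := by
  simp [strictlyAbove]

open Classical in
/-- The father of `u`: the first block strictly containing that of `u`. -/
noncomputable def father (R : Fin (m + 1) → Setoid (Fin (m + 1))) (x : Fin m → Fin (m + 1))
    (u : Fin m) : Option (Fin m) :=
  if h : (strictlyAbove R x u).Nonempty then some ((strictlyAbove R x u).min' h) else none

lemma father_eq_some_iff {u v : Fin m} : father R x u = some v ↔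
    v ∈ strictlyAbove R x u ∧ ∀ w ∈ strictlyAbove R x u, v ≤ w := by
  unfold father
  split_ifs with hne
  · rw [Option.some_inj]
    constructor
    · rintro rfl
      exact ⟨Finset.min'_mem _ _, fun w hw => Finset.min'_le _ w hw⟩
    · rintro ⟨h1, h2⟩
      exact le_antisymm (Finset.min'_le _ v h1) (h2 _ (Finset.min'_mem _ _))
  · refine ⟨fun e => by simp at e, fun e => absurd ⟨v, e.1⟩ hne⟩

lemma exists_father {u v : Fin m} (hv : v ∈ strictlyAbove R x u) :
    ∃ p, father R x u = some p ∧ p ≤ v :=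
  ⟨_, by rw [father, dif_pos ⟨v, hv⟩], Finset.min'_le _ v hv⟩

/-- Stanley's tree of a chain of mergings. -/
noncomputable def IsMergeChain.tree (h : IsMergeChain R x y) : AndreTree m where
  parent := father R x
  lt_parent u v huv := (mem_strictlyAbove.1 (father_eq_some_iff.1 huv).1).1
  root_unique := by
    have key : ∀ u, father R x u = none → (u : ℕ) + 1 = m := by
      intro u hu
      by_contra hne
      have hl : m - 1 < m := by have := u.2; omega
      have hmem : (⟨m - 1, hl⟩ : Fin m) ∈ strictlyAbove R x u := by
        refine mem_strictlyAbove.2 ⟨?_, fun p _ => ?_⟩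
        · rw [Fin.lt_def]; have := u.2; simp only; omega
        · have : (⟨m - 1, hl⟩ : Fin m).succ = Fin.last m := by
            rw [Fin.ext_iff, Fin.val_succ, Fin.val_last]; simp only; omega
          rw [newBlock, mem_cls, this, h.last]
          trivial
      obtain ⟨p, hp, -⟩ := exists_father hmem
      rw [hu] at hp
      simp at hp
    intro u v hu hv
    have := key u hu
    have := key v hv
    rw [Fin.ext_iff]
    omega
  card_sons_le_two v := by
    classical
    -- The block of a son of `v` is still a class just before the `v`-th merging, hence one of the
    -- two classes merged there.
    refine (Finset.card_le_card_of_injOn (newBlock R x)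
      (t := {cls (R v.castSucc) (x v), cls (R v.castSucc) (y v)}) ?_
      h.newBlock_injective.injOn).trans Finset.card_le_two
    intro u hu
    rw [Finset.mem_coe, Finset.mem_filter] at hu
    obtain ⟨h1, h2⟩ := father_eq_some_iff.1 hu.2
    obtain ⟨huv, hs⟩ := mem_strictlyAbove.1 h1
    have hle : u.succ ≤ v.castSucc := by
      rw [Fin.le_def]; simpa using huv
    have hB := h.cls_eq_newBlock v.castSucc hle fun w hw hw' hsub => by
      have := h2 w (mem_strictlyAbove.2 ⟨hw, hsub⟩)
      rw [Fin.le_def] at this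
      rw [Fin.lt_def, Fin.val_castSucc, Fin.val_castSucc] at hw'
      omega
    have hmem := hs (mem_newBlock_left u)
    rw [newBlock, mem_cls, (h.step v).rel_left_iff] at hmem
    rw [Finset.mem_coe, Finset.mem_insert, Finset.mem_singleton, ← hB]
    exact hmem.imp (fun e => (cls_eq_of_rel e).symm) fun e => (cls_eq_of_rel e).symm

lemma IsMergeChain.tree_below_iff (h : IsMergeChain R x y) (u v : Fin m) :
    h.tree.Below u v ↔ newBlock R x u ⊆ newBlock R x v := by
  constructor
  · intro hb
    induction hb with
    | refl => exact subset_rfl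
    | tail _ hp ih =>
      exact ih.trans (mem_strictlyAbove.1 (father_eq_some_iff.1 hp).1).2
  · intro hs
    -- Climbing from `u` to its father, whose label is larger. The father's label is at most `v` and
    -- its block meets that of `v`, hence is contained in it.
    induction hk : m - (u : ℕ) using Nat.strong_induction_on generalizing u with
    | _ k ih =>
      rcases (h.le_of_newBlock_subset hs).eq_or_lt with rfl | hlt
      · exact Relation.ReflTransGen.refl
      · obtain ⟨p, hp, hpv⟩ := exists_father (mem_strictlyAbove.2 ⟨hlt, hs⟩)
        obtain ⟨hup, hs'⟩ := mem_strictlyAbove.1 (father_eq_some_iff.1 hp).1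
        refine Relation.ReflTransGen.head hp (ih (m - p) ?_ p ?_ rfl)
        · rw [Fin.lt_def] at hup
          have := p.2
          omega
        · exact h.newBlock_subset_of_mem hpv (hs' (mem_newBlock_left u)) (hs (mem_newBlock_left u))

lemma AndreTree.le_of_below {T : AndreTree m} {u v : Fin m} (h : T.Below u v) : u ≤ v := by
  induction h with
  | refl => exact le_rfl
  | tail _ hp ih => exact ih.trans (T.lt_parent _ _ hp).le

lemma AndreTree.parent_eq_some_iff {T : AndreTree m} {u v : Fin m} : T.parent u = some v ↔
    T.Below u v ∧ u ≠ v ∧ ∀ w, T.Below u w → u ≠ w → v ≤ w := by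
  have key : ∀ w, T.Below u w → u ≠ w → ∃ p, T.parent u = some p ∧ p ≤ w := by
    intro w hw hne
    rcases Relation.ReflTransGen.cases_head hw with e | ⟨p, hp, hpw⟩
    · exact absurd e hne
    · exact ⟨p, hp, AndreTree.le_of_below hpw⟩
  constructor
  · intro hp
    refine ⟨Relation.ReflTransGen.single hp, (T.lt_parent _ _ hp).ne, fun w hw hne => ?_⟩
    obtain ⟨p, hp', hle⟩ := key w hw hne
    rw [hp, Option.some_inj] at hp'
    rwa [hp']
  · rintro ⟨h1, h2, h3⟩
    obtain ⟨p, hp, hle⟩ := key v h1 h2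
    rw [hp, le_antisymm hle (h3 p (Relation.ReflTransGen.single hp) (T.lt_parent _ _ hp).ne)]

/-- The father is determined by the order: labels increase towards the root, so it is the strict
ancestor with the least label. -/
lemma AndreTree.ext_of_below {T T' : AndreTree m} (h : ∀ u v, T.Below u v ↔ T'.Below u v) :
    T = T' := by
  ext u v
  simp only [AndreTree.parent_eq_some_iff, h]

lemma IsMergeChain.existsUnique_tree (h : IsMergeChain R x y) :
    ∃! T : AndreTree m, IsStanleyImage (fun i => subOf (R i)) T := by
  refine ⟨h.tree, h.isStanleyImage_iff.2 h.tree_below_iff, fun T hT => ?_⟩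
  have hT := h.isStanleyImage_iff.1 hT
  exact AndreTree.ext_of_below fun u v => by rw [hT, h.tree_below_iff]

open Classical in
-- A class of size `s` arises from singletons by `s - 1` mergings. When two classes are merged, the
-- sizes add and one new block is counted.
lemma IsMergeChain.card_newBlock_subset (h : IsMergeChain R x y) (i a : Fin (m + 1)) :
    (Finset.univ.filter fun u : Fin m => u.succ ≤ i ∧ newBlock R x u ⊆ cls (R i) a).card + 1 =
      (cls (R i) a).card := by
  induction i using Fin.induction generalizing a with
  | zero =>
    have h1 : cls (R 0) a = {a} := by
      ext q
      rw [mem_cls, h.zero, Finset.mem_singleton]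
      exact ⟨fun e => Eq.symm e, fun e => e ▸ rfl⟩
    rw [Finset.filter_false_of_mem, h1]
    · rfl
    · exact fun u _ hu => absurd hu.1 (not_le.2 (Fin.succ_pos u))
  | succ j ih =>
    have hs := h.step j
    have hlt : ∀ u : Fin m, u.succ ≤ j.castSucc ↔ u < j := by
      intro u
      rw [Fin.le_def, Fin.lt_def]; simp
    have hsub : ∀ u : Fin m, u < j → ∀ a, newBlock R x u ⊆ cls (R j.castSucc) a ↔
        R j.castSucc a (x u) := by
      intro u hu a
      refine ⟨fun e => mem_cls.1 (e (mem_newBlock_left u)), fun e q hq => ?_⟩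
      exact mem_cls.2 ((R _).trans e (h.monotone ((hlt u).2 hu) (mem_cls.1 hq)))
    have hsub' : ∀ u : Fin m, u ≤ j → ∀ a, newBlock R x u ⊆ cls (R j.succ) a ↔
        R j.succ a (x u) := by
      intro u hu a
      refine ⟨fun e => mem_cls.1 (e (mem_newBlock_left u)), fun e q hq => ?_⟩
      exact mem_cls.2 ((R _).trans e (h.monotone (Fin.succ_le_succ_iff.2 hu) (mem_cls.1 hq)))
    by_cases ha : R j.succ (x j) a
    · rw [← cls_eq_of_rel ha, ← hs.cls_union, Finset.card_union_of_disjoint hs.disjoint_cls,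
        ← ih (x j), ← ih (y j), hs.cls_union]
      have hset : (Finset.univ.filter fun u : Fin m =>
          u.succ ≤ j.succ ∧ newBlock R x u ⊆ cls (R j.succ) (x j)) =
          insert j ((Finset.univ.filter fun u : Fin m =>
            u.succ ≤ j.castSucc ∧ newBlock R x u ⊆ cls (R j.castSucc) (x j)) ∪
            (Finset.univ.filter fun u : Fin m =>
            u.succ ≤ j.castSucc ∧ newBlock R x u ⊆ cls (R j.castSucc) (y j))) := by
        ext u
        simp only [Finset.mem_filter, Finset.mem_univ, true_and, Finset.mem_insert,
          Finset.mem_union, hlt, Fin.succ_le_succ_iff]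
        constructor
        · rintro ⟨h1, h2⟩
          rcases h1.eq_or_lt with e | e
          · exact Or.inl e
          · right
            rw [hsub' u h1, hs.rel_left_iff] at h2
            rw [hsub u e, hsub u e]
            exact h2.imp (fun h => ⟨e, h⟩) fun h => ⟨e, h⟩
        · rintro (rfl | ⟨h1, h2⟩ | ⟨h1, h2⟩)
          · exact ⟨le_rfl, subset_rfl⟩
          · rw [hsub u h1] at h2
            rw [hsub' u h1.le]
            exact ⟨h1.le, hs.rel_left_iff.2 (Or.inl h2)⟩
          · rw [hsub u h1] at h2
            rw [hsub' u h1.le]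
            exact ⟨h1.le, hs.rel_left_iff.2 (Or.inr h2)⟩
      rw [hset, Finset.card_insert_of_notMem, Finset.card_union_of_disjoint]
      · omega
      · rw [Finset.disjoint_left]
        intro u hu hu'
        simp only [Finset.mem_filter, Finset.mem_univ, true_and] at hu hu'
        exact Finset.disjoint_left.1 hs.disjoint_cls (hu.2 (mem_newBlock_left u))
          (hu'.2 (mem_newBlock_left u))
      · simp [hlt]
    · rw [hs.cls_eq_of_not ha, ← ih a]
      congr 2
      ext u
      simp only [Finset.mem_filter, Finset.mem_univ, true_and, hlt, Fin.succ_le_succ_iff]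
      refine and_congr_left fun hu => ⟨fun hle => lt_of_le_of_ne hle ?_, le_of_lt⟩
      rintro rfl
      exact ha (hs.le ((R _).symm (mem_cls.1 (hu (mem_newBlock_left u)))))

lemma IsMergeChain.hook_add_one (h : IsMergeChain R x y) {T : AndreTree m}
    (hT : IsStanleyImage (fun i => subOf (R i)) T) (v : Fin m) :
    T.hook v + 1 = (newBlock R x v).card := by
  classical
  rw [h.isStanleyImage_iff] at hT
  rw [newBlock, ← h.card_newBlock_subset, AndreTree.hook, ← Set.ncard_coe_finset]
  congr 2
  ext u
  simp only [Set.mem_ofPred_eq, hT, Finset.coe_filter, Finset.mem_univ, true_and,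
    Fin.succ_le_succ_iff]
  exact ⟨fun e => ⟨h.le_of_newBlock_subset e, e⟩, fun e => e.2⟩

end TypeA

theorem mainTheorem8 (m : ℕ) (c : TypeA.W m) (hc : TypeA.IsStandardCoxeter c)
    (P : Fin (m + 1) → TypeA.Sub m) (hP : P ∈ TypeA.ncChains c) :
    (∃! T : TypeA.AndreTree m, TypeA.IsStanleyImage P T) ∧
    ∀ T : TypeA.AndreTree m, TypeA.IsStanleyImage P T →
      TypeA.classGenFun c P =
        ∏ v ∈ Finset.univ.filter (fun v : Fin m => T.hook v ≠ 1),
          (2 + Polynomial.X * Polynomial.C ((T.hook v : ℤ) - 1)) := by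
  obtain ⟨R, x, y, hR, rfl⟩ := TypeA.exists_isMergeChain hc.dimFix_eq_zero hP
  refine ⟨hR.existsUnique_tree, fun T hT => ?_⟩
  rw [hR.classGenFun_eq hc.dimFix_eq_zero hc.cutProperty, Finset.prod_filter]
  refine Finset.prod_congr rfl fun v _ => ?_
  have hv := hR.hook_add_one hT v
  rw [← hv]
  by_cases h1 : T.hook v = 1
  -- Since the block has `T.hook v + 1` elements, size two means hook one, and `|B| - 2` is `T.hook
  -- v - 1`.
  · rw [if_pos (by omega), if_neg (by simpa using h1)]
  · rw [if_neg (by omega), if_pos h1]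
    congr 3
    push_cast
    ring
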